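/- Let $n\ge 1$ be an integer and $1\le p<\infty$. Let $X_{\mathbf R^n}=X^+\cup X^-$, where $X^{\pm}=\{x\in\mathbf R^n:\pm x_j\ge 0,\ j=1,\dots,n\}$, equipped with the restriction of the Euclidean metric. Let $w:[0,\infty)\to[0,\infty]$ be such that $x\mapsto w(|x|)$ is locally integrable on $\mathbf R^n$, let $d\mu=w(|x|)\,dx$, and assume that $\mu$ is doubling on $\mathbf R^n$, i.e. that there is $C>0$ such that $0<\mu(B(x,2r))\le C\mu(B(x,r))<\infty$ for all $x\in\mathbf R^n$ and $r>0$. Assume that (the restriction of) $\mu$ supports a $p$-Poincaré inequality on $X=X_{\mathbf R^n}$: there are $C>0$ and $\lambda\ge 1$ such that for all balls $B=B(x,r)$ of $X$ with $x\in X$ and $r>0$, all integrable $f:X\to[-\infty,\infty]$ and all upper gradients $g$ of $f$, $$\frac1{\mu(B)}\int_B|f-f_B|\,d\mu\le C r\Bigl(\frac1{\mu(\lambda B)}\int_{\lambda B}g^p\,d\mu\Bigr)^{1/p},\qquad f_B=\frac1{\mu(B)}\int_B f\,d\mu,\quad \lambda B=B(x,\lambda r).$$ Here a Borel function $g:X\to[0,\infty]$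 is an upper gradient of $f$ if $|f(\gamma(0))-f(\gamma(l))|\le\int_\gamma g\,ds$ for every nonconstant compact rectifiable curve $\gamma:[0,l]\to X$ parametrized by arc length, the left-hand side being $\infty$ if $f(\gamma(0))$ or $f(\gamma(l))$ is infinite. Then $\widetilde w(\rho)=|\rho|^{n-1}w(|\rho|)$ is an $A_p$-weight on $\mathbf R$: it is locally integrable, and there is $C>0$ such that for all bounded open intervals $I\ne\emptyset$, $$\frac1{|I|}\int_I\widetilde w\,d\rho< C\Bigl(\frac1{|I|}\int_I\widetilde w^{\,1/(1-p)}\,d\rho\Bigr)^{1-p}\ \text{ if } p>1,\qquad \frac1{|I|}\int_I\widetilde w\,d\rho< C\operatorname*{ess\,inf}_I\widetilde w\ \text{ if } p=1.$$ -/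

import Mathlib

open MeasureTheory Set
open scoped NNReal ENNReal

namespace BowTie

/-- The closed positive hyperquadrant of `ℝⁿ`. -/
def posQuadrant (n : ℕ) : Set (EuclideanSpace ℝ (Fin n)) := {x | ∀ j, 0 ≤ x j}

/-- The closed negative hyperquadrant of `ℝⁿ`. -/
def negQuadrant (n : ℕ) : Set (EuclideanSpace ℝ (Fin n)) := {x | ∀ j, x j ≤ 0}

/-- The bow-tie in `ℝⁿ`; as a type it carries the restriction of the Euclidean metric. -/
def bowTie (n : ℕ) : Set (EuclideanSpace ℝ (Fin n)) := posQuadrant n ∪ negQuadrant n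

/-- `μ` is doubling: `0 < μ(2B) ≤ C μ(B) < ∞` for all open balls `B`. -/
def IsDoubling {X : Type*} [PseudoMetricSpace X] [MeasurableSpace X] (μ : Measure X) : Prop :=
  ∃ C : ℝ≥0, 0 < C ∧ ∀ (x : X) (r : ℝ), 0 < r →
    0 < μ (Metric.ball x (2 * r)) ∧
    μ (Metric.ball x (2 * r)) ≤ C * μ (Metric.ball x r) ∧
    C * μ (Metric.ball x r) < ∞

/-- `g : X → [0,∞]` is an upper gradient of `f : X → [-∞,∞]`. It suffices to specify curves
through their arc-length parametrization `γ : [0,l] → X`, `l > 0`, for which the line integral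
of `g` is `∫₀ˡ g(γ(t)) dt` (the values of `γ` outside `[0,l]` play no role). In `EReal`,
`(a - b).abs` is `∞` as soon as one of `a`, `b` is infinite, see `abs_sub_eq_top`. -/
def IsUpperGradient {X : Type*} [PseudoMetricSpace X] [MeasurableSpace X]
    (g : X → ℝ≥0∞) (f : X → EReal) : Prop :=
  Measurable g ∧ ∀ (l : ℝ) (γ : ℝ → X), 0 < l → HasUnitSpeedOn γ (Icc 0 l) →
    (f (γ 0) - f (γ l)).abs ≤ ∫⁻ t in Icc 0 l, g (γ t)

theorem abs_sub_eq_top (a b : EReal) (h : a = ⊤ ∨ a = ⊥ ∨ b = ⊤ ∨ b = ⊥) :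
    (a - b).abs = ∞ := by
  induction a <;> induction b <;> simp_all [sub_eq_add_neg]

/-- Integrability of an extended-real-valued function. -/
def IsIntegrable {X : Type*} [MeasurableSpace X] (f : X → EReal) (μ : Measure X) : Prop :=
  AEMeasurable f μ ∧ ∫⁻ x, (f x).abs ∂μ < ∞

/-- `μ` supports a `p`-Poincaré inequality on `X`. An integrable `f` is finite almost everywhere,
so that its mean value over a ball is the mean value of `(f y).toReal`. -/
def SupportsPoincare {X : Type*} [PseudoMetricSpace X] [MeasurableSpace X]
    (p : ℝ) (μ : Measure X) : Prop :=
  ∃ (C : ℝ≥0) (lam : ℝ), 0 < C ∧ 1 ≤ lam ∧ ∀ (x : X) (r : ℝ), 0 < r →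
    ∀ (f : X → EReal) (g : X → ℝ≥0∞), IsIntegrable f μ → IsUpperGradient g f →
      ⨍⁻ y in Metric.ball x r,
          (f y - ((⨍ z in Metric.ball x r, (f z).toReal ∂μ : ℝ) : EReal)).abs ∂μ
        ≤ C * ENNReal.ofReal r * (⨍⁻ y in Metric.ball x (lam * r), g y ^ p ∂μ) ^ (1 / p)

/-- A weight: a nonnegative, locally (Lebesgue) integrable function. -/
def IsWeight {E : Type*} [TopologicalSpace E] [MeasureSpace E] (w : E → ℝ≥0∞) : Prop :=
  AEMeasurable w volume ∧ ∀ K : Set E, IsCompact K → ∫⁻ x in K, w x < ∞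

open Classical in
/-- A Muckenhoupt `A_p`-weight, `1 ≤ p < ∞`. -/
def IsApWeight {E : Type*} [PseudoMetricSpace E] [MeasureSpace E] (p : ℝ) (w : E → ℝ≥0∞) :
    Prop :=
  IsWeight w ∧ ∃ C : ℝ≥0, 0 < C ∧ ∀ (x : E) (r : ℝ), 0 < r →
    ⨍⁻ y in Metric.ball x r, w y ∂volume <
      C * (if p = 1 then essInf w (volume.restrict (Metric.ball x r))
        else (⨍⁻ y in Metric.ball x r, w y ^ (1 / (1 - p)) ∂volume) ^ (1 - p))

end BowTie

/-! ### Geometry of the bow-tie and the signed norm. -/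

namespace BowTie

/-! The signed norm, `|x|` on the positive part and `-|x|` on the negative part, is a Lipschitz map
from the bow-tie to the line. By polar coordinates it pushes `μ` forward to a constant multiple of
`W(t) dt`, where `W(t) = |t|^(n-1) w(|t|)`. Passing through the origin is what links negative and
positive heights, so intervals `I` around `0` are treated like any others.

Let `G ≥ 0` be bounded and supported in `I = (m - r, m + r)`, and let `H` be a primitive of `G`.
Then `H ∘ signedNorm` has upper gradient `2 (G ∘ signedNorm)`. On a ball of radius `7r` centred at
height within `2r` of `m`, it equals `0` on one portion and `∫ G` on another, both of comparable
measure by doubling. The Poincaré inequality therefore bounds `(∫ G)^p` by `r^p` times a mean of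
`G^p` (`local_estimate`). For `|m|` much larger than `r` such a ball sees only a piece of the shell
over `I`. Integrating over all centres with respect to Lebesgue measure and using Tonelli produces
the same factor `r^n` on both sides and replaces balls by shells (`shell_estimate`). In polar
coordinates this reads `(∫_I G)^p ∫_I W ≤ K r^p ∫_I G^p W` (`profile_estimate`).

This testing inequality yields `A_p`: for `p > 1` take `G` close to `W^(1/(1-p))`, so that `G^p W`
is about `G`; for `p = 1` take the indicator of a sublevel set of `W` (`ap_bound_of_testing`). -/

open Classical in
/-- The norm of `x`, with a negative sign off the positive hyperquadrant. -/
noncomputable def signedNorm {n : ℕ} (x : EuclideanSpace ℝ (Fin n)) : ℝ :=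
  if x ∈ posQuadrant n then ‖x‖ else -‖x‖

variable {n : ℕ} {x y z : EuclideanSpace ℝ (Fin n)}

theorem signedNorm_of_mem_pos (hx : x ∈ posQuadrant n) : signedNorm x = ‖x‖ := if_pos hx

theorem eq_zero_of_mem_pos_of_mem_neg (hx : x ∈ posQuadrant n) (hx' : x ∈ negQuadrant n) :
    x = 0 := by
  ext j
  exact le_antisymm (hx' j) (hx j)

theorem signedNorm_of_mem_neg (hx : x ∈ negQuadrant n) : signedNorm x = -‖x‖ := by
  by_cases h : x ∈ posQuadrant n
  · simp [eq_zero_of_mem_pos_of_mem_neg h hx, signedNorm]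
  · exact if_neg h

theorem abs_signedNorm (x : EuclideanSpace ℝ (Fin n)) : |signedNorm x| = ‖x‖ := by
  unfold signedNorm
  split_ifs <;> simp

/-- Vectors in opposite quadrants have nonpositive inner product, so `|x - y|² ≥ |x|² + |y|² ≥ (|x|
+ |y|)² / 2`. The sharp constant `√2` is rounded up to `2`. -/
theorem norm_add_norm_le_of_mem (hx : x ∈ posQuadrant n) (hy : y ∈ negQuadrant n) :
    ‖x‖ + ‖y‖ ≤ 2 * ‖x - y‖ := by
  have h : inner ℝ x y ≤ 0 := by
    rw [PiLp.inner_apply]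
    refine Finset.sum_nonpos fun i _ => ?_
    simpa [mul_comm] using mul_nonpos_of_nonneg_of_nonpos (hx i) (hy i)
  have h2 := norm_sub_sq_real x y
  refine abs_le_of_sq_le_sq' ?_ (by positivity) |>.2
  nlinarith [sq_nonneg (‖x‖ - ‖y‖)]

theorem abs_signedNorm_sub_le (hx : x ∈ bowTie n) (hy : y ∈ bowTie n) :
    |signedNorm x - signedNorm y| ≤ 2 * ‖x - y‖ := by
  have h1 := abs_norm_sub_norm_le x y
  have h0 := norm_nonneg (x - y)
  rcases hx with hx | hx <;> rcases hy with hy | hy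
  · rw [signedNorm_of_mem_pos hx, signedNorm_of_mem_pos hy]; linarith
  · rw [signedNorm_of_mem_pos hx, signedNorm_of_mem_neg hy, sub_neg_eq_add,
      abs_of_nonneg (by positivity)]
    exact norm_add_norm_le_of_mem hx hy
  · rw [signedNorm_of_mem_neg hx, signedNorm_of_mem_pos hy, abs_sub_comm, sub_neg_eq_add,
      abs_of_nonneg (by positivity), norm_sub_rev]
    exact norm_add_norm_le_of_mem hy hx
  · rw [signedNorm_of_mem_neg hx, signedNorm_of_mem_neg hy, abs_sub_comm, neg_sub_neg]; linarith

theorem signedNorm_smul {ω : EuclideanSpace ℝ (Fin n)} (hω : ω ∈ posQuadrant n) (h1 : ‖ω‖ = 1)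
    (t : ℝ) : t • ω ∈ bowTie n ∧ signedNorm (t • ω) = t := by
  rcases le_total 0 t with ht | ht
  · have : t • ω ∈ posQuadrant n := fun j => mul_nonneg ht (hω j)
    exact ⟨Or.inl this, by rw [signedNorm_of_mem_pos this, norm_smul, h1, Real.norm_of_nonneg ht,
      mul_one]⟩
  · have : t • ω ∈ negQuadrant n := fun j => mul_nonpos_of_nonpos_of_nonneg ht (hω j)
    exact ⟨Or.inr this, by rw [signedNorm_of_mem_neg this, norm_smul, h1, Real.norm_of_nonpos ht,
      mul_one, neg_neg]⟩

theorem exists_unit_mem_pos (hn : 1 ≤ n) : ∃ ω ∈ posQuadrant n, ‖ω‖ = 1 := by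
  refine ⟨EuclideanSpace.single ⟨0, hn⟩ 1, fun j => ?_, by simp⟩
  by_cases h : j = ⟨0, hn⟩ <;> simp [h]

theorem exists_ray (hn : 1 ≤ n) (hx : x ∈ bowTie n) :
    ∃ ω ∈ posQuadrant n, ‖ω‖ = 1 ∧ x = signedNorm x • ω := by
  rcases eq_or_ne x 0 with rfl | h0
  · obtain ⟨ω, hω, h1⟩ := exists_unit_mem_pos hn
    exact ⟨ω, hω, h1, by simp [signedNorm]⟩
  have hx0 : ‖x‖ ≠ 0 := norm_ne_zero_iff.2 h0
  rcases hx with hx | hx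
  · refine ⟨‖x‖⁻¹ • x, fun j => mul_nonneg (by positivity) (hx j), ?_, ?_⟩
    · rw [norm_smul, norm_inv, norm_norm, inv_mul_cancel₀ hx0]
    · rw [signedNorm_of_mem_pos hx, smul_smul, mul_inv_cancel₀ hx0, one_smul]
  · refine ⟨-(‖x‖⁻¹ • x), fun j => ?_, ?_, ?_⟩
    · simpa using mul_nonpos_of_nonneg_of_nonpos (inv_nonneg.2 (norm_nonneg x)) (hx j)
    · rw [norm_neg, norm_smul, norm_inv, norm_norm, inv_mul_cancel₀ hx0]
    · rw [signedNorm_of_mem_neg hx, smul_neg, neg_smul, neg_neg, smul_smul, mul_inv_cancel₀ hx0,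
        one_smul]

/-- Move `z` along the diagonal by `δ / n` in each coordinate, into its own quadrant. A ball of
radius `δ / n` changes coordinates by less than that, and the displacement has norm at most `δ`.
With doubling of `μ` on the whole space, this shows that balls centred in the bow-tie keep a fixed
share of their mass inside it. -/
theorem exists_ball_subset_bowTie (hn : 1 ≤ n) (hz : z ∈ bowTie n) {δ : ℝ} (hδ : 0 < δ) :
    ∃ z', Metric.ball z' (δ / n) ⊆ bowTie n ∩ Metric.ball z (2 * δ) := by
  have hn' : (1 : ℝ) ≤ n := by exact_mod_cast hn
  have hε : 0 < δ / n := by positivity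
  have hεδ : δ / n ≤ δ := div_le_self hδ.le hn'
  let e : EuclideanSpace ℝ (Fin n) := WithLp.toLp 2 fun _ => δ / n
  have he : ‖e‖ ≤ δ := by
    rw [EuclideanSpace.norm_eq]
    apply Real.sqrt_le_iff.2 ⟨hδ.le, ?_⟩
    simp only [e, Real.norm_of_nonneg hε.le, Finset.sum_const, Finset.card_univ, Fintype.card_fin,
      nsmul_eq_mul]
    calc (n : ℝ) * (δ / n) ^ 2 = δ * (δ / n) := by field_simp
      _ ≤ δ ^ 2 := by nlinarith
  have hcoord : ∀ {v u : EuclideanSpace ℝ (Fin n)}, v ∈ Metric.ball u (δ / n) →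
      ∀ j, |v j - u j| < δ / n := fun {v u} hv j => by
    have h := PiLp.norm_apply_le (v - u) j
    rw [mem_ball_iff_norm] at hv
    exact lt_of_le_of_lt (by simpa using h) hv
  rcases hz with hz | hz
  · refine ⟨z + e, fun v hv => ⟨Or.inl fun j => ?_, ?_⟩⟩
    · have h := (abs_lt.1 (hcoord hv j)).1
      have h2 := hz j
      simp only [PiLp.add_apply, e] at h
      linarith
    · rw [mem_ball_iff_norm] at hv ⊢
      calc ‖v - z‖ = ‖(v - (z + e)) + e‖ := by congr 1; abel
        _ ≤ ‖v - (z + e)‖ + ‖e‖ := norm_add_le _ _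
        _ < 2 * δ := by linarith
  · refine ⟨z - e, fun v hv => ⟨Or.inr fun j => ?_, ?_⟩⟩
    · have h := (abs_lt.1 (hcoord hv j)).2
      have h2 := hz j
      simp only [PiLp.sub_apply, e] at h
      linarith
    · rw [mem_ball_iff_norm] at hv ⊢
      calc ‖v - z‖ = ‖(v - (z - e)) - e‖ := by congr 1; abel
        _ ≤ ‖v - (z - e)‖ + ‖e‖ := norm_sub_le _ _
        _ < 2 * δ := by linarith

theorem isClosed_posQuadrant : IsClosed (posQuadrant n) := by
  simp only [posQuadrant, ofPred_forall]
  exact isClosed_iInter fun j => isClosed_le continuous_const (by fun_prop)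

theorem isClosed_negQuadrant : IsClosed (negQuadrant n) := by
  simp only [negQuadrant, ofPred_forall]
  exact isClosed_iInter fun j => isClosed_le (by fun_prop) continuous_const

theorem measurableSet_bowTie : MeasurableSet (bowTie n) :=
  (isClosed_posQuadrant.union isClosed_negQuadrant).measurableSet

theorem measurable_signedNorm : Measurable (signedNorm : EuclideanSpace ℝ (Fin n) → ℝ) :=
  Measurable.ite isClosed_posQuadrant.measurableSet measurable_norm measurable_norm.neg

theorem lipschitzWith_signedNorm :
    LipschitzWith 2 fun x : bowTie n => signedNorm (x : EuclideanSpace ℝ (Fin n)) :=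
  LipschitzWith.of_dist_le_mul fun x y => by
    simpa [Real.dist_eq, Subtype.dist_eq, dist_eq_norm] using abs_signedNorm_sub_le x.2 y.2

/-! ### Upper gradients of functions of a Lipschitz height. -/

/-- Line integrals of `φ ∘ h` along a Lipschitz function `h` dominate the integral of `φ` between
the end points. -/
theorem lintegral_uIcc_le_of_lipschitzOnWith {K : ℝ≥0} {h : ℝ → ℝ} {l : ℝ} (hl : 0 ≤ l)
    (hh : LipschitzOnWith K h (Icc 0 l)) {φ : ℝ → ℝ≥0∞} (hφ : Measurable φ) :
    ∫⁻ s in uIcc (h 0) (h l), φ s ≤ K * ∫⁻ t in Icc 0 l, φ (h t) := by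
  have hcont := hh.continuousOn
  have hm : AEMeasurable h (volume.restrict (Icc 0 l)) := hcont.aemeasurable measurableSet_Icc
  have hle : volume.restrict (uIcc (h 0) (h l)) ≤
      (K : ℝ≥0∞) • (volume.restrict (Icc 0 l)).map h := by
    refine Measure.le_iff.2 fun A hA => ?_
    rw [Measure.restrict_apply hA, Measure.smul_apply, Measure.map_apply_of_aemeasurable hm hA,
      Measure.restrict_apply' measurableSet_Icc, smul_eq_mul]
    -- By the intermediate value theorem `h` reaches every height between its end values. A
    -- `K`-Lipschitz map multiplies one-dimensional Hausdorff measure, which is length on the line,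
    -- by at most `K`.
    have hsub : A ∩ uIcc (h 0) (h l) ⊆ h '' (h ⁻¹' A ∩ Icc 0 l) := by
      rintro s ⟨hs, hs'⟩
      rw [← uIcc_of_le hl] at hcont ⊢
      obtain ⟨t, ht, rfl⟩ := intermediate_value_uIcc hcont hs'
      exact ⟨t, ⟨hs, ht⟩, rfl⟩
    refine (measure_mono hsub).trans ?_
    have := (hh.mono (inter_subset_right (s := h ⁻¹' A))).hausdorffMeasure_image_le zero_le_one
    simpa [hausdorffMeasure_real] using this
  calc ∫⁻ s in uIcc (h 0) (h l), φ s
      ≤ ∫⁻ s, φ s ∂((K : ℝ≥0∞) • (volume.restrict (Icc 0 l)).map h) := lintegral_mono' hle le_rfl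
    _ = _ := by
      rw [lintegral_smul_measure, lintegral_map' hφ.aemeasurable hm, smul_eq_mul]

theorem _root_.HasUnitSpeedOn.lipschitzOnWith {E : Type*} [PseudoEMetricSpace E] {γ : ℝ → E}
    {s : Set ℝ} (h : HasUnitSpeedOn γ s) : LipschitzOnWith 1 γ s := by
  have key : ∀ a ∈ s, ∀ b ∈ s, a ≤ b → edist (γ a) (γ b) ≤ edist a b := fun a ha b hb hab => by
    have h1 := h ha hb
    have h2 := eVariationOn.edist_le γ (s := s ∩ Icc a b) ⟨ha, left_mem_Icc.2 hab⟩
      ⟨hb, right_mem_Icc.2 hab⟩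
    rw [h1] at h2
    rw [edist_comm a b, edist_dist b a, Real.dist_eq, abs_of_nonneg (sub_nonneg.2 hab)]
    simpa using h2
  intro a ha b hb
  rw [ENNReal.coe_one, one_mul]
  rcases le_total a b with hab | hab
  · exact key a ha b hb hab
  · rw [edist_comm, edist_comm a b]
    exact key b hb a ha hab

/-- Compositions of primitives with Lipschitz functions have the obvious upper gradient. -/
theorem isUpperGradient_integral_comp {X : Type*} [PseudoMetricSpace X] [MeasurableSpace X]
    [BorelSpace X] {K : ℝ≥0} {u : X → ℝ} (hu : LipschitzWith K u) {G : ℝ → ℝ}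
    (hG : Measurable G) (hGi : Integrable G) (a : ℝ) :
    IsUpperGradient (fun x => K * ‖G (u x)‖ₑ)
      (fun x => ((∫ t in a..u x, G t : ℝ) : EReal)) := by
  refine ⟨(hG.enorm.comp hu.continuous.measurable).const_mul _, fun l γ hl hγ => ?_⟩
  have hlip : LipschitzOnWith K (u ∘ γ) (Icc 0 l) := by
    simpa using hu.comp_lipschitzOnWith hγ.lipschitzOnWith
  have h1 := lintegral_uIcc_le_of_lipschitzOnWith hl.le hlip hG.enorm
  rw [lintegral_const_mul' _ _ ENNReal.coe_ne_top]
  refine le_trans ?_ h1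
  rw [← EReal.coe_sub, intervalIntegral.integral_interval_sub_left hGi.intervalIntegrable
    hGi.intervalIntegrable, EReal.abs_def, ← Real.norm_eq_abs, ofReal_norm,
    intervalIntegral.integral_symm, enorm_neg, ← ofReal_norm,
    intervalIntegral.norm_integral_eq_norm_integral_uIoc, ofReal_norm]
  exact (enorm_integral_le_lintegral_enorm _).trans (lintegral_mono_set uIoc_subset_uIcc)

end BowTie

/-! ### Polar coordinates and measurability of radial profiles. -/

namespace BowTie

variable {n : ℕ}

theorem lintegral_volumeIoiPow (k : ℕ) {Φ : ℝ → ℝ≥0∞} (hΦ : Measurable Φ) :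
    ∫⁻ r, Φ r ∂Measure.volumeIoiPow k = ∫⁻ t in Ioi 0, (‖t‖₊ : ℝ≥0∞) ^ k * Φ t := by
  have hΦ' : Measurable fun r : Ioi (0 : ℝ) => Φ r := hΦ.comp measurable_subtype_coe
  rw [Measure.volumeIoiPow, lintegral_withDensity_eq_lintegral_mul _ (by fun_prop) hΦ']
  rw [← lintegral_subtype_comap measurableSet_Ioi]
  refine lintegral_congr fun r => ?_
  have hr : (0 : ℝ) ≤ r := le_of_lt r.2
  rw [Pi.mul_apply, ENNReal.ofReal_pow hr, ← enorm_eq_nnnorm, Real.enorm_of_nonneg hr]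

/-- The surface measure of the part of the unit sphere in the positive hyperquadrant. -/
noncomputable def sphereMass (n : ℕ) : ℝ≥0∞ :=
  (volume : Measure (EuclideanSpace ℝ (Fin n))).toSphere (Subtype.val ⁻¹' posQuadrant n)

theorem sphereMass_ne_top : sphereMass n ≠ ∞ := measure_ne_top _ _

/-- The quadrant is a cone, so its indicator depends on the direction only and the integrand factors
over sphere times half-line. -/
theorem lintegral_posQuadrant_norm {Φ : ℝ → ℝ≥0∞} (hΦ : Measurable Φ) (hn : 1 ≤ n) :
    ∫⁻ x in posQuadrant n, Φ ‖x‖ =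
      sphereMass n * ∫⁻ t in Ioi 0, (‖t‖₊ : ℝ≥0∞) ^ (n - 1) * Φ t := by
  have : NeZero n := ⟨by omega⟩
  have hm : MeasurableSet (posQuadrant n) := isClosed_posQuadrant.measurableSet
  have hm' : MeasurableSet ((Subtype.val : Metric.sphere (0 : EuclideanSpace ℝ (Fin n)) 1 → _) ⁻¹'
    posQuadrant n) := measurable_subtype_coe hm
  have mp := (volume : Measure (EuclideanSpace ℝ (Fin n))).measurePreserving_homeomorphUnitSphereProd
  have hcone : ∀ x : ({0}ᶜ : Set (EuclideanSpace ℝ (Fin n))),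
      ((homeomorphUnitSphereProd _ x).1 : EuclideanSpace ℝ (Fin n)) ∈ posQuadrant n ↔
        (x : EuclideanSpace ℝ (Fin n)) ∈ posQuadrant n := fun x => by
    have hx : 0 < ‖(x : EuclideanSpace ℝ (Fin n))‖ := norm_pos_iff.2 x.2
    simp only [homeomorphUnitSphereProd_apply_fst_coe, posQuadrant, mem_ofPred_eq, PiLp.smul_apply,
      smul_eq_mul]
    exact forall_congr' fun j => mul_nonneg_iff_of_pos_left (inv_pos.2 hx)
  have hfin : Module.finrank ℝ (EuclideanSpace ℝ (Fin n)) = n := by simp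
  calc ∫⁻ x in posQuadrant n, Φ ‖x‖
      = ∫⁻ x, (posQuadrant n).indicator (fun x => Φ ‖x‖) x := (lintegral_indicator hm _).symm
    _ = ∫⁻ x : ({0}ᶜ : Set (EuclideanSpace ℝ (Fin n))),
          (posQuadrant n).indicator (fun x => Φ ‖x‖) x ∂(volume.comap Subtype.val) := by
      rw [lintegral_subtype_comap (measurableSet_singleton _).compl, restrict_compl_singleton]
    _ = ∫⁻ q, (Subtype.val ⁻¹' posQuadrant n).indicator (fun _ => 1) q.1 * Φ q.2
          ∂((volume : Measure (EuclideanSpace ℝ (Fin n))).toSphere.prod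
            (Measure.volumeIoiPow (n - 1))) := by
      rw [hfin] at mp
      rw [← mp.lintegral_comp_emb (Homeomorph.measurableEmbedding _)]
      refine lintegral_congr fun x => ?_
      by_cases hx : (x : EuclideanSpace ℝ (Fin n)) ∈ posQuadrant n
      · rw [indicator_of_mem hx, indicator_of_mem (by exact (hcone x).2 hx)]; simp
      · rw [indicator_of_notMem hx, indicator_of_notMem (by exact fun h => hx ((hcone x).1 h))]
        simp
    _ = _ := by
      have hΦ' : Measurable fun r : Ioi (0 : ℝ) => Φ r := hΦ.comp measurable_subtype_coe
      rw [lintegral_prod_mul ((measurable_const.indicator hm').aemeasurable) hΦ'.aemeasurable,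
        lintegral_volumeIoiPow _ hΦ,
        lintegral_indicator hm']
      simp [sphereMass]

theorem lintegral_bowTie_signedNorm {Φ : ℝ → ℝ≥0∞} (hΦ : Measurable Φ) (hn : 1 ≤ n) :
    ∫⁻ x in bowTie n, Φ (signedNorm x) =
      sphereMass n * ∫⁻ t, (‖t‖₊ : ℝ≥0∞) ^ (n - 1) * Φ t := by
  have : NeZero n := ⟨by omega⟩
  have hdisj : AEDisjoint volume (posQuadrant n) (negQuadrant n) :=
    measure_mono_null (fun x hx => eq_zero_of_mem_pos_of_mem_neg hx.1 hx.2)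
      (measure_singleton (0 : EuclideanSpace ℝ (Fin n)))
  have hneg : ∫⁻ x in negQuadrant n, Φ (-‖x‖) = ∫⁻ x in posQuadrant n, Φ (-‖x‖) := by
    have h := (Measure.measurePreserving_neg
      (volume : Measure (EuclideanSpace ℝ (Fin n)))).setLIntegral_comp_preimage_emb
      (Homeomorph.neg _).measurableEmbedding (fun x => Φ (-‖x‖)) (posQuadrant n)
    rw [← h]
    have : (Neg.neg ⁻¹' posQuadrant n : Set (EuclideanSpace ℝ (Fin n))) = negQuadrant n := by
      ext x; simp [posQuadrant, negQuadrant]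
    rw [this]
    simp
  have hneg' : ∫⁻ t in Iio (0 : ℝ), (‖t‖₊ : ℝ≥0∞) ^ (n - 1) * Φ t =
      ∫⁻ t in Ioi (0 : ℝ), (‖t‖₊ : ℝ≥0∞) ^ (n - 1) * Φ (-t) := by
    have h := (Measure.measurePreserving_neg (volume : Measure ℝ)).setLIntegral_comp_preimage_emb
      (Homeomorph.neg _).measurableEmbedding
      (fun t => (‖t‖₊ : ℝ≥0∞) ^ (n - 1) * Φ t) (Iio 0)
    rw [← h]
    simp
  have hsplit : ∫⁻ t : ℝ, (‖t‖₊ : ℝ≥0∞) ^ (n - 1) * Φ t =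
      (∫⁻ t in Ioi (0 : ℝ), (‖t‖₊ : ℝ≥0∞) ^ (n - 1) * Φ t) +
        ∫⁻ t in Iio (0 : ℝ), (‖t‖₊ : ℝ≥0∞) ^ (n - 1) * Φ t := by
    rw [← lintegral_add_compl _ (measurableSet_Ioi (a := (0 : ℝ))), compl_Ioi,
      setLIntegral_congr Iio_ae_eq_Iic]
  rw [bowTie, Measure.restrict_union₀ hdisj isClosed_negQuadrant.nullMeasurableSet,
    lintegral_add_measure,
    setLIntegral_congr_fun isClosed_posQuadrant.measurableSet
      (fun x hx => congrArg Φ (signedNorm_of_mem_pos hx) :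
        EqOn (fun x => Φ (signedNorm x)) (fun x => Φ ‖x‖) _),
    setLIntegral_congr_fun isClosed_negQuadrant.measurableSet
      (fun x hx => congrArg Φ (signedNorm_of_mem_neg hx) :
        EqOn (fun x => Φ (signedNorm x)) (fun x => Φ (-‖x‖)) _), hneg,
    lintegral_posQuadrant_norm hΦ hn,
    lintegral_posQuadrant_norm (Φ := fun t => Φ (-t)) (hΦ.comp measurable_neg) hn, hsplit, hneg',
    mul_add]

/-- If it vanished, the polar formula with `Φ = 1` would make the bow-tie a null set, although it
contains a ball. -/
theorem sphereMass_ne_zero (hn : 1 ≤ n) : sphereMass n ≠ 0 := by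
  intro h
  have h1 := lintegral_bowTie_signedNorm (n := n) (Φ := fun _ => 1) measurable_const hn
  rw [h, zero_mul, setLIntegral_one] at h1
  obtain ⟨z', hz'⟩ := exists_ball_subset_bowTie hn (z := 0)
    (Or.inl fun _ => le_rfl) one_pos
  have h2 := measure_mono_null (hz'.trans inter_subset_left) h1
  exact (Metric.measure_ball_pos volume z' (by positivity : (0 : ℝ) < 1 / n)).ne' h2

/-- A measurable radial function has a measurable profile, up to null sets. -/
theorem exists_measurable_profile (hn : 1 ≤ n) {w : ℝ≥0 → ℝ≥0∞}
    (hw : AEMeasurable (fun x : EuclideanSpace ℝ (Fin n) => w ‖x‖₊)) :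
    ∃ w' : ℝ≥0 → ℝ≥0∞, Measurable w' ∧
      (fun x : EuclideanSpace ℝ (Fin n) => w ‖x‖₊) =ᵐ[volume] (fun x => w' ‖x‖₊) ∧
      (fun t : ℝ => w ‖t‖₊) =ᵐ[volume] fun t => w' ‖t‖₊ := by
  have : NeZero n := ⟨by omega⟩
  have mp := (volume : Measure (EuclideanSpace ℝ (Fin n))).measurePreserving_homeomorphUnitSphereProd
  have mps := MeasurePreserving.symm (homeomorphUnitSphereProd
    (EuclideanSpace ℝ (Fin n))).toMeasurableEquiv mp
  have hw1 : AEMeasurable (fun x : ({0}ᶜ : Set (EuclideanSpace ℝ (Fin n))) => w ‖(x : EuclideanSpace ℝ (Fin n))‖₊)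
      (volume.comap Subtype.val) := by
    have e := MeasurableEmbedding.subtype_coe (α := EuclideanSpace ℝ (Fin n))
      (measurableSet_singleton (0 : EuclideanSpace ℝ (Fin n))).compl
    have h2 : AEMeasurable (fun x : EuclideanSpace ℝ (Fin n) => w ‖x‖₊)
      (Measure.map Subtype.val (Measure.comap (Subtype.val : ({0}ᶜ : Set (EuclideanSpace ℝ (Fin n))) → _) volume)) := by
      rw [e.map_comap]; exact hw.restrict
    exact e.aemeasurable_map_iff.1 h2
  have hw2 := (hw1.comp_quasiMeasurePreserving mps.quasiMeasurePreserving).aestronglyMeasurable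
  have hw3 : AEStronglyMeasurable (fun r : Ioi (0 : ℝ) => w ‖(r : ℝ)‖₊)
      (Measure.volumeIoiPow (Module.finrank ℝ (EuclideanSpace ℝ (Fin n)) - 1)) := by
    -- In polar coordinates the radial function depends on the second factor only, and measurability
    -- descends to that factor because the sphere has nonzero measure.
    refine AEStronglyMeasurable.of_comp_snd (μ := (volume : Measure (EuclideanSpace ℝ (Fin n))).toSphere)
      (hw2.congr (.of_forall fun q => ?_)) (Measure.toSphere_ne_zero _)
    have h4 : ‖(q.1 : EuclideanSpace ℝ (Fin n))‖₊ = 1 := by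
      ext; simp
    change w ‖(((homeomorphUnitSphereProd (EuclideanSpace ℝ (Fin n))).symm q : _) : EuclideanSpace ℝ (Fin n))‖₊ = _
    rw [homeomorphUnitSphereProd_symm_apply_coe, nnnorm_smul, h4, mul_one]
  obtain ⟨v, hv, hvw⟩ := hw3.aemeasurable
  refine ⟨fun s => if h : (0 : ℝ) < s then v ⟨s, h⟩ else 0, ?_, ?_, ?_⟩
  · exact Measurable.dite (s := {s : ℝ≥0 | (0 : ℝ) < s})
      (f := fun s => v ⟨s.1, s.2⟩) (g := fun _ => 0)
      (hv.comp (Measurable.subtype_mk (by fun_prop))) measurable_const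
      (measurableSet_lt measurable_const (by fun_prop))
  · have h1 := mp.quasiMeasurePreserving.ae (Measure.quasiMeasurePreserving_snd.ae hvw)
    have h2 := (ae_restrict_iff_subtype (μ := (volume : Measure (EuclideanSpace ℝ (Fin n))))
      (measurableSet_singleton (0 : EuclideanSpace ℝ (Fin n))).compl
      (p := fun x => w ‖x‖₊ = if h : (0 : ℝ) < ‖x‖₊ then v ⟨‖x‖₊, h⟩ else 0)).2 (by
        filter_upwards [h1] with x hx
        have hx0 : (0 : ℝ) < ‖(x : EuclideanSpace ℝ (Fin n))‖₊ := 
          norm_pos_iff.2 x.2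
        rw [dif_pos hx0]
        convert hx using 2
        all_goals ext; simp)
    rwa [restrict_compl_singleton] at h2
  · have h1 : ∀ᵐ r : Ioi (0 : ℝ) ∂(volume.comap Subtype.val), w ‖(r : ℝ)‖₊ = v r := by
      -- The density `r^(n-1)` is positive on the half-line, so null sets for the radial measure are
      -- Lebesgue null.
      refine Measure.AbsolutelyContinuous.ae_le (withDensity_absolutelyContinuous' (by fun_prop) ?_) hvw
      exact .of_forall fun r => by
        have := r.2.out
        simp only [ne_eq, ENNReal.ofReal_eq_zero, not_le]
        positivity
    have h2 := (ae_restrict_iff_subtype (μ := (volume : Measure ℝ)) measurableSet_Ioi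
      (p := fun x => w ‖x‖₊ = if h : (0 : ℝ) < ‖x‖₊ then v ⟨‖x‖₊, h⟩ else 0)).2 (by
        filter_upwards [h1] with x hx
        have hx0 : (0 : ℝ) < ‖(x : ℝ)‖₊ := by simpa using x.2.out.ne'
        rw [dif_pos hx0, hx]
        congr 1
        ext
        simp [abs_of_pos x.2.out])
    rw [ae_restrict_iff' measurableSet_Ioi] at h2
    have h3 := (Measure.measurePreserving_neg (volume : Measure ℝ)).quasiMeasurePreserving.ae h2
    filter_upwards [h2, h3, Measure.ae_ne volume (0 : ℝ)] with t ht ht' h0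
    rcases lt_or_gt_of_ne h0 with h | h
    · have := ht' (neg_pos.2 h)
      simpa only [nnnorm_neg] using this
    · exact ht h

end BowTie

/-! ### Doubling measures, oscillation and test functions. -/

namespace BowTie

section Doubling

variable {X : Type*} [PseudoMetricSpace X] [MeasurableSpace X] {μ : Measure X}

theorem IsDoubling.measure_ball_pos (h : IsDoubling μ) (x : X) {r : ℝ} (hr : 0 < r) :
    0 < μ (Metric.ball x r) := by
  obtain ⟨C, -, h⟩ := h
  simpa [mul_div_cancel₀] using (h x (r / 2) (by positivity)).1

theorem IsDoubling.measure_ball_lt_top (h : IsDoubling μ) (x : X) (r : ℝ) :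
    μ (Metric.ball x r) < ∞ := by
  rcases le_or_gt r 0 with hr | hr
  · simp [Metric.ball_eq_empty.2 hr]
  obtain ⟨C, -, h⟩ := h
  have := h x (r / 2) (by positivity)
  simpa [mul_div_cancel₀] using this.2.1.trans_lt this.2.2

theorem IsDoubling.exists_measure_ball_le (h : IsDoubling μ) (Λ : ℝ) :
    ∃ D : ℝ≥0, ∀ (x : X) (r : ℝ), 0 < r →
      μ (Metric.ball x (Λ * r)) ≤ D * μ (Metric.ball x r) := by
  obtain ⟨C, -, h⟩ := h
  obtain ⟨k, hk⟩ := pow_unbounded_of_one_lt Λ (one_lt_two (α := ℝ))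
  refine ⟨C ^ k, fun x r hr => ?_⟩
  have key : ∀ j : ℕ, μ (Metric.ball x (2 ^ j * r)) ≤ (C : ℝ≥0∞) ^ j * μ (Metric.ball x r) := by
    intro j
    induction j with
    | zero => simp
    | succ j ih =>
      rw [pow_succ', pow_succ', mul_assoc, mul_assoc]
      exact (h x (2 ^ j * r) (by positivity)).2.1.trans (by gcongr)
  rw [ENNReal.coe_pow]
  exact (measure_mono (Metric.ball_subset_ball (by gcongr))).trans (key k)

end Doubling

/-- A function that is `0` on one part and `F` on another part of `B` has oscillation `≳ F`. -/
theorem const_mul_measure_le_of_two_values {X : Type*} [MeasurableSpace X] {ν : Measure X}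
    {B P N : Set X} (hP : P ⊆ B) (hN : N ⊆ B) (hPm : MeasurableSet P) (hNm : MeasurableSet N)
    {D : ℝ≥0} (hDP : ν B ≤ D * ν P) (hDN : ν B ≤ D * ν N) {f : X → ℝ} {F : ℝ}
    (hfP : ∀ x ∈ P, f x = F) (hfN : ∀ x ∈ N, f x = 0) (a : ℝ) :
    ‖F‖ₑ * ν B ≤ 2 * D * ∫⁻ x in B, ((f x : EReal) - (a : EReal)).abs ∂ν := by
  have habs : ∀ x, ((f x : EReal) - (a : EReal)).abs = ‖f x - a‖ₑ := fun x => by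
    rw [← EReal.coe_sub, EReal.abs_def, ← Real.norm_eq_abs, ofReal_norm]
  simp only [habs]
  have aux : ∀ {S : Set X} {b : ℝ}, S ⊆ B → MeasurableSet S → ν B ≤ D * ν S →
      (∀ x ∈ S, f x = b) → ‖b - a‖ₑ * ν B ≤ D * ∫⁻ x in B, ‖f x - a‖ₑ ∂ν := by
    intro S b hS hSm hD hf
    calc ‖b - a‖ₑ * ν B ≤ ‖b - a‖ₑ * (D * ν S) := by gcongr
      _ = D * ∫⁻ x in S, ‖b - a‖ₑ ∂ν := by rw [setLIntegral_const]; ring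
      _ = D * ∫⁻ x in S, ‖f x - a‖ₑ ∂ν := by
        congr 1
        exact setLIntegral_congr_fun hSm fun x hx => by simp only [hf x hx]
      _ ≤ _ := by gcongr
  -- No `a` is close to both values: the triangle inequality through `a` splits `F` into the two
  -- deviations, each carried by its own part of `B`.
  calc ‖F‖ₑ * ν B ≤ (‖F - a‖ₑ + ‖0 - a‖ₑ) * ν B := by
        gcongr
        calc ‖F‖ₑ = ‖(F - a) - (0 - a)‖ₑ := by congr 1; ring
          _ ≤ _ := enorm_sub_le
    _ ≤ D * (∫⁻ x in B, ‖f x - a‖ₑ ∂ν) + D * ∫⁻ x in B, ‖f x - a‖ₑ ∂ν := by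
      rw [add_mul]
      exact add_le_add (aux hP hPm hDP hfP) (aux hN hNm hDN hfN)
    _ = _ := by ring

/-- A primitive of `G`, brought back to `0` far to the right. -/
theorem exists_cutoff_primitive {G : ℝ → ℝ≥0} (hG : Measurable G) {M : ℝ≥0} (hM : ∀ t, G t ≤ M)
    {a b R : ℝ} (hab : a ≤ b) (hbR : b ≤ R) (hsupp : ∀ t, t ∉ Ioo a b → G t = 0) :
    ∃ (G₀ : ℝ → ℝ) (T : ℝ), Measurable G₀ ∧ Integrable G₀ ∧ (∀ t ≤ R, G₀ t = G t) ∧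
      (∀ t ≤ a, ∫ s in a..t, G₀ s = 0) ∧ (∀ t ∈ Icc b R, ∫ s in a..t, G₀ s = ∫ s, (G s : ℝ)) ∧
      ∀ t, T ≤ |t| → ∫ s in a..t, G₀ s = 0 := by
  set F : ℝ := ∫ s, (G s : ℝ) with hF
  have hGm : Measurable fun t => (G t : ℝ) := hG.coe_nnreal_real
  have hGon : IntegrableOn (fun t => (G t : ℝ)) (Ioo a b) :=
    Measure.integrableOn_of_bounded (M := M) measure_Ioo_lt_top.ne hGm.aestronglyMeasurable
      (.of_forall fun t => by simpa using hM t)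
  have hGi : Integrable fun t => (G t : ℝ) :=
    hGon.integrable_of_forall_notMem_eq_zero fun t ht => by simp [hsupp t ht]
  have hGI : ∀ c, b ≤ c → ∫ s in a..c, (G s : ℝ) = F := fun c hc => by
    rw [intervalIntegral.integral_of_le (hab.trans hc), hF]
    refine setIntegral_eq_integral_of_forall_compl_eq_zero fun t ht => ?_
    rw [hsupp t fun h => ht ⟨h.1, h.2.le.trans hc⟩, NNReal.coe_zero]
  -- This block has total mass `F`; subtracting it cancels the primitive beyond `R + 1`. The test
  -- function then has bounded support, which makes it integrable, and nothing changes up to `R`.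
  have hχi : Integrable ((Ioc R (R + 1)).indicator fun _ => F) :=
    (integrable_indicator_iff measurableSet_Ioc).2 (integrableOn_const measure_Ioc_lt_top.ne)
  have hsub : ∀ c, ∫ s in a..c, ((G s : ℝ) - (Ioc R (R + 1)).indicator (fun _ => F) s) =
      (∫ s in a..c, (G s : ℝ)) - ∫ s in a..c, (Ioc R (R + 1)).indicator (fun _ => F) s := fun c =>
    intervalIntegral.integral_sub hGi.intervalIntegrable hχi.intervalIntegrable
  have hleft : ∀ t ≤ a,
      ∫ s in a..t, ((G s : ℝ) - (Ioc R (R + 1)).indicator (fun _ => F) s) = 0 := fun t ht => by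
    rw [intervalIntegral.integral_symm, neg_eq_zero, intervalIntegral.integral_of_le ht]
    refine setIntegral_eq_zero_of_forall_eq_zero fun s hs => ?_
    rw [hsupp s fun h => absurd hs.2 h.1.not_ge, indicator_of_notMem fun h => ?_]
    · simp
    · linarith [h.1, hs.2]
  refine ⟨fun t => G t - (Ioc R (R + 1)).indicator (fun _ => F) t, max |a| (|R| + 1), ?_,
    hGi.sub hχi, fun t ht => ?_, hleft, fun t ht => ?_, fun t ht => ?_⟩
  · exact hGm.sub (measurable_const.indicator measurableSet_Ioc)
  · change (G t : ℝ) - (Ioc R (R + 1)).indicator (fun _ => F) t = G t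
    rw [indicator_of_notMem fun h => h.1.not_ge ht, sub_zero]
  · rw [hsub, hGI t ht.1, intervalIntegral.integral_of_le (hab.trans ht.1),
      setIntegral_eq_zero_of_forall_eq_zero fun s hs => ?_, sub_zero]
    exact indicator_of_notMem (fun h => h.1.not_ge (hs.2.trans ht.2)) _
  · rcases le_or_gt t 0 with h0 | h0
    · apply hleft
      rw [abs_of_nonpos h0] at ht
      linarith [le_max_left |a| (|R| + 1), neg_abs_le a]
    · rw [abs_of_pos h0] at ht
      have hR : R + 1 ≤ t := by linarith [le_max_right |a| (|R| + 1), le_abs_self R]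
      rw [hsub, hGI t (by linarith), intervalIntegral.integral_of_le (by linarith),
        setIntegral_indicator measurableSet_Ioc,
        inter_eq_self_of_subset_right (Ioc_subset_Ioc (by linarith) hR)]
      simp

variable {n : ℕ} {p : ℝ} {μ : Measure (EuclideanSpace ℝ (Fin n))}

theorem isIntegrable_comp_signedNorm (hdoubling : IsDoubling μ) {H : ℝ → ℝ} (hH : Measurable H)
    {M T : ℝ} (hM : ∀ t, |H t| ≤ M) (hT : ∀ t, T ≤ |t| → H t = 0) :
    IsIntegrable (fun x : bowTie n => ((H (signedNorm (x : EuclideanSpace ℝ (Fin n))) : ℝ) : EReal))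
      (μ.comap Subtype.val) := by
  refine ⟨((hH.comp lipschitzWith_signedNorm.continuous.measurable).coe_real_ereal).aemeasurable,
    ?_⟩
  simp only [EReal.abs_def]
  rw [lintegral_subtype_comap measurableSet_bowTie
    (fun x => ENNReal.ofReal |H (signedNorm x)|)]
  calc ∫⁻ x in bowTie n, ENNReal.ofReal |H (signedNorm x)| ∂μ
      ≤ ∫⁻ x, ENNReal.ofReal |H (signedNorm x)| ∂μ := setLIntegral_le_lintegral _ _
    _ ≤ ∫⁻ x, (Metric.ball 0 T).indicator (fun _ => ENNReal.ofReal M) x ∂μ := by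
      refine lintegral_mono fun x => ?_
      by_cases hx : x ∈ Metric.ball 0 T
      · rw [indicator_of_mem hx]
        exact ENNReal.ofReal_le_ofReal (hM _)
      · rw [indicator_of_notMem hx, hT, abs_zero, ENNReal.ofReal_zero]
        rw [abs_signedNorm]
        simpa using hx
    _ = ENNReal.ofReal M * μ (Metric.ball 0 T) := by
      rw [lintegral_indicator Metric.isOpen_ball.measurableSet, setLIntegral_const]
    _ < ∞ := ENNReal.mul_lt_top ENNReal.ofReal_lt_top (hdoubling.measure_ball_lt_top _ _)

theorem comap_ball (y : bowTie n) (r : ℝ) :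
    μ.comap Subtype.val (Metric.ball y r) = μ (bowTie n ∩ Metric.ball (y : EuclideanSpace ℝ (Fin n)) r) := by
  rw [comap_subtype_coe_apply measurableSet_bowTie]
  congr 1
  exact Subtype.image_preimage_coe (bowTie n) (Metric.ball (y : EuclideanSpace ℝ (Fin n)) r)

theorem setLIntegral_comap_ball (y : bowTie n) (r : ℝ) (φ : EuclideanSpace ℝ (Fin n) → ℝ≥0∞) :
    ∫⁻ x in Metric.ball y r, φ x ∂(μ.comap Subtype.val) =
      ∫⁻ x in bowTie n ∩ Metric.ball (y : EuclideanSpace ℝ (Fin n)) r, φ x ∂μ := by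
  rw [setLIntegral_subtype measurableSet_bowTie]
  congr 2
  exact Subtype.image_preimage_coe (bowTie n) (Metric.ball (y : EuclideanSpace ℝ (Fin n)) r)

end BowTie

/-! ### The Poincaré inequality on one ball. -/

namespace BowTie

variable {n : ℕ} {p : ℝ} {μ : Measure (EuclideanSpace ℝ (Fin n))}

theorem abs_signedNorm_sub_lt_of_mem_ball {x y : EuclideanSpace ℝ (Fin n)} (hx : x ∈ bowTie n)
    (hy : y ∈ bowTie n) {r : ℝ} (h : x ∈ Metric.ball y r) :
    |signedNorm x - signedNorm y| < 2 * r := by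
  rw [mem_ball_iff_norm] at h
  linarith [abs_signedNorm_sub_le hx hy]

/-- Along the ray through `y` one finds balls of comparable measure at prescribed heights. -/
theorem exists_ball_of_height (hn : 1 ≤ n) {D : ℝ≥0}
    (hD : ∀ (x : EuclideanSpace ℝ (Fin n)) (r : ℝ), 0 < r →
      μ (Metric.ball x (28 * n * r)) ≤ D * μ (Metric.ball x r))
    {y : EuclideanSpace ℝ (Fin n)} (hy : y ∈ bowTie n) {r : ℝ} (hr : 0 < r) {s : ℝ}
    (hs : |s| = 5 * r) :
    ∃ P, MeasurableSet P ∧ P ⊆ bowTie n ∩ Metric.ball y (7 * r) ∧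
      (∀ x ∈ P, |signedNorm x - (signedNorm y + s)| < 2 * r) ∧
      μ (bowTie n ∩ Metric.ball y (7 * r)) ≤ D * μ P := by
  have hn' : (0 : ℝ) < n := by exact_mod_cast hn
  obtain ⟨ω, hω, hω1, hyω⟩ := exists_ray hn hy
  obtain ⟨hz, hzs⟩ := signedNorm_smul hω hω1 (signedNorm y + s)
  obtain ⟨z', hz'⟩ := exists_ball_subset_bowTie hn hz (half_pos hr)
  have hsub : Metric.ball z' (r / 2 / n) ⊆ bowTie n ∩ Metric.ball y (7 * r) := fun x hx => by
    refine ⟨(hz' hx).1, ?_⟩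
    have h1 := (hz' hx).2
    rw [Metric.mem_ball] at h1 ⊢
    have h2 : dist ((signedNorm y + s) • ω) y = 5 * r := by
      nth_rw 2 [hyω]
      rw [dist_eq_norm, ← sub_smul, norm_smul, hω1, mul_one, add_sub_cancel_left, Real.norm_eq_abs,
        hs]
    linarith [dist_triangle x ((signedNorm y + s) • ω) y]
  refine ⟨_, Metric.isOpen_ball.measurableSet, hsub, fun x hx => ?_, ?_⟩
  · have := abs_signedNorm_sub_lt_of_mem_ball (hz' hx).1 hz (hz' hx).2
    rw [hzs] at this
    linarith
  · refine le_trans (measure_mono (inter_subset_right.trans ?_)) (hD z' _ (by positivity))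
    have h3 := (hsub (Metric.mem_ball_self (by positivity))).2
    rw [Metric.mem_ball'] at h3
    refine Metric.ball_subset_ball' ?_
    -- The ball found has radius `r / (2n)` and centre within `7r` of `y`, so its dilation to radius
    -- `14r` covers the ball of radius `7r` about `y`.
    have : 28 * n * (r / 2 / n) = 14 * r := by field_simp; norm_num
    linarith

/-- The Poincaré inequality applied to the primitive of `G ∘ signedNorm` on a single ball. -/
theorem local_estimate (hn : 1 ≤ n) (hp : 1 ≤ p) (hdoubling : IsDoubling μ)
    (hPI : SupportsPoincare p (μ.comap (Subtype.val : bowTie n → EuclideanSpace ℝ (Fin n)))) :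
    ∃ (K : ℝ≥0) (Λ : ℝ), 1 ≤ Λ ∧ ∀ (m r : ℝ), 0 < r → ∀ (G : ℝ → ℝ≥0) (M : ℝ≥0), Measurable G →
      (∀ t, G t ≤ M) → (∀ t, t ∉ Ioo (m - r) (m + r) → G t = 0) →
      ∀ y ∈ bowTie n, |signedNorm y - m| < 2 * r →
        (∫⁻ t, G t) ^ p * μ (bowTie n ∩ Metric.ball y r) ≤
          (K * ENNReal.ofReal r ^ p) *
            ∫⁻ x in bowTie n ∩ Metric.ball y (Λ * r), (G (signedNorm x) : ℝ≥0∞) ^ p ∂μ := by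
  obtain ⟨C, lam, -, hlam, hPI⟩ := hPI
  obtain ⟨D, hD⟩ := hdoubling.exists_measure_ball_le (28 * n)
  have hp0 : 0 < p := by linarith
  refine ⟨(2 * D * C * 7 * 2) ^ p, lam * 7, by linarith, ?_⟩
  intro m r hr G M hG hM hsupp y hy hym
  -- An upper bound for all heights on the dilated ball: the centre lies below `m + 2r` and the
  -- signed norm is `2`-Lipschitz. The cutoff is thus invisible in the Poincaré inequality.
  set R := m + 2 * r + 2 * (lam * (7 * r)) with hRdef
  have hlr : 7 * r ≤ lam * (7 * r) := le_mul_of_one_le_left (by positivity) hlam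
  have hR : m + r ≤ R := by linarith
  obtain ⟨G₀, T, hG₀m, hG₀i, hG₀, hHl, hHr, hHT⟩ :=
    exists_cutoff_primitive hG hM (a := m - r) (b := m + r) (R := R) (by linarith) hR hsupp
  set H : ℝ → ℝ := fun t => ∫ s in (m - r)..t, G₀ s with hH
  set F : ℝ := ∫ s, (G s : ℝ) with hF
  have hFe : ‖F‖ₑ = ∫⁻ t, G t := by
    have h := integral_eq_lintegral_of_nonneg_ae (μ := volume) (f := fun t => (G t : ℝ))
      (.of_forall fun t => (G t).2) hG.coe_nnreal_real.aestronglyMeasurable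
    have hfin : ∫⁻ t, (G t : ℝ≥0∞) ≠ ∞ := by
      have hle : ∀ t, (G t : ℝ≥0∞) ≤ (Ioo (m - r) (m + r)).indicator (fun _ => (M : ℝ≥0∞)) t := by
        intro t
        by_cases ht : t ∈ Ioo (m - r) (m + r)
        · rw [indicator_of_mem ht]; exact_mod_cast hM t
        · rw [hsupp t ht]; simp
      refine ((lintegral_mono hle).trans_lt ?_).ne
      rw [lintegral_indicator measurableSet_Ioo, setLIntegral_const]
      exact ENNReal.mul_lt_top ENNReal.coe_lt_top measure_Ioo_lt_top
    simp only [ENNReal.ofReal_coe_nnreal] at h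
    rw [hF, h, Real.enorm_of_nonneg ENNReal.toReal_nonneg, ENNReal.ofReal_toReal hfin]
  have hHcont : Continuous H := intervalIntegral.continuous_primitive
    (fun _ _ => hG₀i.intervalIntegrable) _
  have hHbdd : ∀ t, |H t| ≤ ∫ s, ‖G₀ s‖ := fun t => by
    rw [hH, ← Real.norm_eq_abs]
    refine intervalIntegral.norm_integral_le_integral_norm_uIoc.trans ?_
    exact setIntegral_le_integral hG₀i.norm (.of_forall fun _ => norm_nonneg _)
  set ν := μ.comap (Subtype.val : bowTie n → EuclideanSpace ℝ (Fin n)) with hν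
  have hint := isIntegrable_comp_signedNorm (n := n) hdoubling hHcont.measurable hHbdd hHT
  have hug := isUpperGradient_integral_comp (lipschitzWith_signedNorm (n := n)) hG₀m hG₀i (m - r)
  have hpi := hPI ⟨y, hy⟩ (7 * r) (by positivity) _ _ hint hug
  set a : ℝ := ⨍ z in Metric.ball (⟨y, hy⟩ : bowTie n) (7 * r),
    ((H (signedNorm (z : EuclideanSpace ℝ (Fin n))) : ℝ) : EReal).toReal ∂ν
  have hheight : ∀ x ∈ bowTie n ∩ Metric.ball y (lam * (7 * r)), signedNorm x ≤ R := by
    intro x hx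
    have h1 := abs_lt.1 (abs_signedNorm_sub_lt_of_mem_ball hx.1 hy hx.2)
    have h2 := abs_lt.1 hym
    linarith [h1.2, h2.2]
  -- The centre is within `2r` of height `m` and `P` varies by less than `2r` about its height, so a
  -- shift by `5r` puts `P` above `m + r`. Symmetrically `N` lies below `m - r`.
  obtain ⟨P, hPm, hPsub, hPh, hPD⟩ := exists_ball_of_height hn hD hy hr
    (s := 5 * r) (abs_of_pos (by positivity))
  obtain ⟨N, hNm, hNsub, hNh, hND⟩ := exists_ball_of_height hn hD hy hr
    (s := -(5 * r)) (by rw [abs_neg, abs_of_pos (by positivity)])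
  have hball : ∀ s, ν (Metric.ball (⟨y, hy⟩ : bowTie n) s) = μ (bowTie n ∩ Metric.ball y s) :=
    fun s => comap_ball _ _
  have hpre : ∀ S ⊆ bowTie n, ν (Subtype.val ⁻¹' S) = μ S := fun S hS => by
    rw [hν, comap_subtype_coe_apply measurableSet_bowTie, Subtype.image_preimage_coe,
      inter_eq_self_of_subset_right hS]
  have hosc := const_mul_measure_le_of_two_values (ν := ν)
    (B := Metric.ball (⟨y, hy⟩ : bowTie n) (7 * r)) (P := Subtype.val ⁻¹' P)
    (N := Subtype.val ⁻¹' N) (D := D) (F := F)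
    (f := fun x => H (signedNorm (x : EuclideanSpace ℝ (Fin n))))
    (fun x hx => (hPsub hx).2) (fun x hx => (hNsub hx).2)
    (measurable_subtype_coe hPm) (measurable_subtype_coe hNm)
    (by rw [hball, hpre P (hPsub.trans inter_subset_left)]; exact hPD)
    (by rw [hball, hpre N (hNsub.trans inter_subset_left)]; exact hND)
    (fun x hx => hHr _ ⟨by
        have h1 := abs_lt.1 (hPh x hx)
        have h2 := abs_lt.1 hym
        linarith [h1.1, h2.1], hheight x ⟨x.2, Metric.ball_subset_ball hlr (hPsub hx).2⟩⟩)
    (fun x hx => hHl _ (by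
        have h1 := abs_lt.1 (hNh x hx)
        have h2 := abs_lt.1 hym
        linarith [h1.2, h2.2])) a
  have hμfin : ∀ s, μ (bowTie n ∩ Metric.ball y s) ≠ ∞ := fun s =>
    ((measure_mono inter_subset_right).trans_lt (hdoubling.measure_ball_lt_top y s)).ne
  have hμpos : ∀ s, 0 < s → μ (bowTie n ∩ Metric.ball y s) ≠ 0 := fun s hs => by
    obtain ⟨z', hz'⟩ := exists_ball_subset_bowTie hn hy (half_pos hs)
    rw [mul_div_cancel₀ _ two_ne_zero] at hz'
    have hn' : (0 : ℝ) < n := by exact_mod_cast hn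
    exact ((hdoubling.measure_ball_pos z' (by positivity)).trans_le (measure_mono hz')).ne'
  rw [setLAverage_eq, setLAverage_eq, hball, hball] at hpi
  rw [hball] at hosc
  set b := μ (bowTie n ∩ Metric.ball y (7 * r)) with hb
  set B := μ (bowTie n ∩ Metric.ball y (lam * (7 * r))) with hB
  have hgrad : ∫⁻ x in Metric.ball (⟨y, hy⟩ : bowTie n) (lam * (7 * r)),
      (((2 : ℝ≥0) : ℝ≥0∞) * ‖G₀ (signedNorm (x : EuclideanSpace ℝ (Fin n)))‖ₑ) ^ p ∂ν =
      2 ^ p * ∫⁻ x in bowTie n ∩ Metric.ball y (lam * (7 * r)),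
        (G (signedNorm x) : ℝ≥0∞) ^ p ∂μ := by
    rw [setLIntegral_comap_ball ⟨y, hy⟩ _
      (fun x => (((2 : ℝ≥0) : ℝ≥0∞) * ‖G₀ (signedNorm x)‖ₑ) ^ p),
      ← lintegral_const_mul' _ _ (by simp)]
    refine setLIntegral_congr_fun (measurableSet_bowTie.inter Metric.isOpen_ball.measurableSet)
      fun x hx => ?_
    rw [hG₀ _ (hheight x hx), ENNReal.mul_rpow_of_nonneg _ _ hp0.le, Real.enorm_of_nonneg (G _).coe_nonneg,
      ENNReal.ofReal_coe_nnreal]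
    simp
  rw [hgrad] at hpi
  set J := ∫⁻ x in bowTie n ∩ Metric.ball y (lam * (7 * r)), (G (signedNorm x) : ℝ≥0∞) ^ p ∂μ
  have h1 : ‖F‖ₑ ≤ 2 * D * (C * ENNReal.ofReal (7 * r) * (2 ^ p * J / B) ^ (1 / p)) := by
    refine le_trans ?_ (mul_le_mul_right hpi _)
    rw [← mul_div_assoc, ENNReal.le_div_iff_mul_le (Or.inl (hμpos _ (by positivity)))
      (Or.inl (hμfin _))]
    exact hosc
  have h2 : ‖F‖ₑ ^ p ≤ (2 * D * C * 7 * ENNReal.ofReal r) ^ p * (2 ^ p * J / B) := by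
    refine (ENNReal.rpow_le_rpow h1 hp0.le).trans_eq ?_
    rw [ENNReal.ofReal_mul (by norm_num), ← mul_assoc, ENNReal.mul_rpow_of_nonneg _ _ hp0.le,
      ← ENNReal.rpow_mul, one_div_mul_cancel hp0.ne', ENNReal.rpow_one]
    congr 2
    rw [ENNReal.ofReal_ofNat]
    ring
  rw [← hFe]
  -- Multiplying by `B` removes the denominator of the mean; on the left only the ball of radius `r`
  -- is kept, which suffices for the averaging over centres.
  have hbB : μ (bowTie n ∩ Metric.ball y r) ≤ B := by
    apply measure_mono
    gcongr
    linarith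
  calc ‖F‖ₑ ^ p * μ (bowTie n ∩ Metric.ball y r)
      ≤ (2 * D * C * 7 * ENNReal.ofReal r) ^ p * (2 ^ p * J / B) * B := by gcongr
    _ = (2 * D * C * 7 * ENNReal.ofReal r) ^ p * (2 ^ p * J) := by
      rw [mul_assoc, ENNReal.div_mul_cancel (hμpos _ (by positivity)) (hμfin _)]
    _ = ↑((2 * D * C * 7 * 2) ^ p) * ENNReal.ofReal r ^ p * J := by
      rw [ENNReal.coe_rpow_of_nonneg _ hp0.le, ENNReal.mul_rpow_of_nonneg _ _ hp0.le]
      push_cast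
      rw [ENNReal.mul_rpow_of_nonneg (2 * (D : ℝ≥0∞) * C * 7) 2 hp0.le]
      ring
    _ = _ := by rw [mul_assoc lam 7 r]

end BowTie

/-! ### From balls to shells, and down to the line. -/

namespace BowTie

variable {n : ℕ} {p : ℝ} {μ : Measure (EuclideanSpace ℝ (Fin n))}

/-- Tonelli for the symmetric relation `dist x y < s`. -/
theorem lintegral_setLIntegral_ball {X : Type*} [PseudoMetricSpace X] [MeasurableSpace X]
    [OpensMeasurableSpace X] [SecondCountableTopology X] {μ ν : Measure X} [SFinite μ] [SFinite ν]
    {A S : Set X} {φ : X → ℝ≥0∞} (hφ : Measurable φ) (s : ℝ) :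
    ∫⁻ y in A, ∫⁻ x in S ∩ Metric.ball y s, φ x ∂μ ∂ν =
      ∫⁻ x in S, φ x * ν (A ∩ Metric.ball x s) ∂μ := by
  have hm : MeasurableSet {q : X × X | dist q.2 q.1 < s} :=
    measurableSet_lt (by fun_prop) measurable_const
  have h1 : ∀ y, ∫⁻ x in S ∩ Metric.ball y s, φ x ∂μ =
      ∫⁻ x in S, {q : X × X | dist q.2 q.1 < s}.indicator (fun q => φ q.2) (y, x) ∂μ := fun y => by
    rw [inter_comm, ← Measure.restrict_restrict Metric.isOpen_ball.measurableSet,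
      ← lintegral_indicator Metric.isOpen_ball.measurableSet]
    rfl
  simp_rw [h1]
  have hm' : Measurable ({q : X × X | dist q.2 q.1 < s}.indicator fun q => φ q.2) :=
    (hφ.comp measurable_snd).indicator hm
  rw [lintegral_lintegral_swap (f := fun y x =>
    {q : X × X | dist q.2 q.1 < s}.indicator (fun q => φ q.2) (y, x)) hm'.aemeasurable]
  refine lintegral_congr fun x => ?_
  have h2 : ∀ y, {q : X × X | dist q.2 q.1 < s}.indicator (fun q => φ q.2) (y, x) =
      (Metric.ball x s).indicator (fun _ => φ x) y := fun y => by
    simp only [indicator, mem_ofPred_eq, Metric.mem_ball']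
  simp_rw [h2]
  rw [lintegral_indicator Metric.isOpen_ball.measurableSet, setLIntegral_const,
    Measure.restrict_apply Metric.isOpen_ball.measurableSet, inter_comm]

/-- Averaging the local estimate over all centres near the spherical shell of radius `|m|`. -/
theorem shell_estimate [SFinite μ] (hn : 1 ≤ n) (hp : 1 ≤ p) (hdoubling : IsDoubling μ)
    (hPI : SupportsPoincare p (μ.comap (Subtype.val : bowTie n → EuclideanSpace ℝ (Fin n)))) :
    ∃ K : ℝ≥0, ∀ (m r : ℝ), 0 < r → ∀ (G : ℝ → ℝ≥0) (M : ℝ≥0), Measurable G →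
      (∀ t, G t ≤ M) → (∀ t, t ∉ Ioo (m - r) (m + r) → G t = 0) →
      (∫⁻ t, G t) ^ p * μ (bowTie n ∩ signedNorm ⁻¹' Metric.ball m r) ≤
        (K * ENNReal.ofReal r ^ p) *
          ∫⁻ x in bowTie n, (G (signedNorm x) : ℝ≥0∞) ^ p ∂μ := by
  obtain ⟨K, Λ, hΛ, hloc⟩ := local_estimate hn hp hdoubling hPI
  have hn' : (0 : ℝ) < n := by exact_mod_cast hn
  have : NeZero n := ⟨by omega⟩
  -- The extra factor is the ratio of the volumes of balls of radii `Λ r` and `r / (4n)`, the upper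
  -- and lower bounds for the set of centres near a given point.
  refine ⟨K * (4 * n * Λ).toNNReal ^ n, fun m r hr G M hG hM hsupp => ?_⟩
  set A := bowTie n ∩ signedNorm ⁻¹' Metric.ball m (2 * r) with hAdef
  set A' := bowTie n ∩ signedNorm ⁻¹' Metric.ball m r with hA'def
  have hA : MeasurableSet A :=
    measurableSet_bowTie.inter (measurable_signedNorm Metric.isOpen_ball.measurableSet)
  have hA' : MeasurableSet A' :=
    measurableSet_bowTie.inter (measurable_signedNorm Metric.isOpen_ball.measurableSet)
  set v : EuclideanSpace ℝ (Fin n) → ℝ → ℝ≥0∞ := fun x s => volume (Metric.ball x s) with hv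
  have hvol : ∀ x s, 0 ≤ s → v x s = ENNReal.ofReal (s ^ n) * v 0 1 := fun x s hs => by
    simpa using Measure.addHaar_ball (volume : Measure (EuclideanSpace ℝ (Fin n))) x hs
  have hG' : Measurable fun x : EuclideanSpace ℝ (Fin n) => (G (signedNorm x) : ℝ≥0∞) ^ p :=
    ((hG.comp measurable_signedNorm).coe_nnreal_ennreal).pow_const p
  have hlow : ∀ x ∈ A', v 0 (r / 4 / n) ≤ volume (A ∩ Metric.ball x r) := fun x hx => by
    obtain ⟨z', hz'⟩ := exists_ball_subset_bowTie hn hx.1 (δ := r / 4) (by positivity)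
    rw [hvol 0 _ (by positivity), ← hvol z' _ (by positivity)]
    refine measure_mono fun u hu => ?_
    have hu' := hz' hu
    have h1 := abs_signedNorm_sub_lt_of_mem_ball hu'.1 hx.1 hu'.2
    have h2 := hx.2
    rw [mem_preimage, Metric.mem_ball, Real.dist_eq] at h2
    refine ⟨⟨hu'.1, ?_⟩, Metric.ball_subset_ball (by linarith) hu'.2⟩
    rw [mem_preimage, Metric.mem_ball, Real.dist_eq]
    linarith [abs_sub_le (signedNorm u) (signedNorm x) m]
  have hup : v 0 (Λ * r) = ((4 * n * Λ).toNNReal : ℝ≥0∞) ^ n * v 0 (r / 4 / n) := by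
    rw [hvol 0 _ (by positivity), hvol 0 (r / 4 / n) (by positivity), ← mul_assoc]
    congr 1
    rw [← ENNReal.coe_pow, ← Real.toNNReal_pow (by positivity), ← ENNReal.ofReal,
      ← ENNReal.ofReal_mul (by positivity), ← mul_pow]
    congr 2
    field_simp
  have hlow' : μ A' * v 0 (r / 4 / n) ≤ ∫⁻ y in A, μ (bowTie n ∩ Metric.ball y r) := by
    have h := lintegral_setLIntegral_ball (μ := μ) (ν := volume) (A := A) (S := bowTie n)
      (φ := fun _ => 1) measurable_const r
    simp only [setLIntegral_one, one_mul] at h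
    rw [h, mul_comm, ← setLIntegral_const]
    calc ∫⁻ x in A', v 0 (r / 4 / n) ∂μ ≤ ∫⁻ x in A', volume (A ∩ Metric.ball x r) ∂μ :=
          setLIntegral_mono' hA' hlow
      _ ≤ _ := lintegral_mono_set inter_subset_left
  set F := ∫⁻ t, (G t : ℝ≥0∞)
  set J := ∫⁻ x in bowTie n, (G (signedNorm x) : ℝ≥0∞) ^ p ∂μ with hJ
  have hv0 : v 0 (r / 4 / n) ≠ 0 := (Metric.measure_ball_pos _ _ (by positivity)).ne'
  have hvt : v 0 (r / 4 / n) ≠ ∞ := measure_ball_lt_top.ne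
  refine (ENNReal.mul_le_mul_iff_left hv0 hvt).1 ?_
  calc F ^ p * μ A' * v 0 (r / 4 / n)
      ≤ F ^ p * ∫⁻ y in A, μ (bowTie n ∩ Metric.ball y r) := by rw [mul_assoc]; gcongr
    _ ≤ ∫⁻ y in A, F ^ p * μ (bowTie n ∩ Metric.ball y r) := lintegral_const_mul_le _ _
    _ ≤ ∫⁻ y in A, (K * ENNReal.ofReal r ^ p) *
          ∫⁻ x in bowTie n ∩ Metric.ball y (Λ * r), (G (signedNorm x) : ℝ≥0∞) ^ p ∂μ :=
      setLIntegral_mono' hA fun y hy => hloc m r hr G M hG hM hsupp y hy.1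
        (by simpa [Real.dist_eq] using hy.2)
    _ = (K * ENNReal.ofReal r ^ p) *
          ∫⁻ x in bowTie n, (G (signedNorm x) : ℝ≥0∞) ^ p * volume (A ∩ Metric.ball x (Λ * r)) ∂μ := by
      rw [lintegral_const_mul', lintegral_setLIntegral_ball hG']
      exact ENNReal.mul_ne_top ENNReal.coe_ne_top
        (ENNReal.rpow_ne_top_of_nonneg (by linarith) ENNReal.ofReal_ne_top)
    _ ≤ (K * ENNReal.ofReal r ^ p) *
          ∫⁻ x in bowTie n, (G (signedNorm x) : ℝ≥0∞) ^ p * v 0 (Λ * r) ∂μ := by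
      gcongr with x
      rw [hvol 0 _ (by positivity), ← hvol x _ (by positivity)]
      exact measure_mono inter_subset_right
    _ = _ := by
      rw [lintegral_mul_const _ hG', hup, ← hJ]
      push_cast
      ring

/-- The one-dimensional inequality satisfied by the profile of a radial weight. -/
theorem profile_estimate (hn : 1 ≤ n) (hp : 1 ≤ p) {w : ℝ≥0 → ℝ≥0∞} (hw : Measurable w)
    (hμ : μ = volume.withDensity fun x => w ‖x‖₊) (hdoubling : IsDoubling μ)
    (hPI : SupportsPoincare p (μ.comap (Subtype.val : bowTie n → EuclideanSpace ℝ (Fin n))))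
    {W : ℝ → ℝ≥0∞} (hW : W = fun t => (‖t‖₊ : ℝ≥0∞) ^ (n - 1) * w ‖t‖₊) :
    (∀ (m r : ℝ), 0 < r → 0 < ∫⁻ t in Metric.ball m r, W t) ∧
    (∀ (m r : ℝ), 0 < r → ∫⁻ t in Metric.ball m r, W t < ∞) ∧
    ∃ K : ℝ≥0, ∀ (m r : ℝ), 0 < r → ∀ (G : ℝ → ℝ≥0) (M : ℝ≥0), Measurable G → (∀ t, G t ≤ M) →
      (∫⁻ t in Metric.ball m r, G t) ^ p * ∫⁻ t in Metric.ball m r, W t ≤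
        (K * ENNReal.ofReal r ^ p) * ∫⁻ t in Metric.ball m r, (G t : ℝ≥0∞) ^ p * W t := by
  have hp0 : 0 < p := by linarith
  have hwm : Measurable fun x : EuclideanSpace ℝ (Fin n) => w ‖x‖₊ := hw.comp measurable_nnnorm
  have : SFinite μ := by rw [hμ]; infer_instance
  have hpolar : ∀ Φ : ℝ → ℝ≥0∞, Measurable Φ →
      ∫⁻ x in bowTie n, Φ (signedNorm x) ∂μ = sphereMass n * ∫⁻ t, Φ t * W t := by
    intro Φ hΦ
    have hΦ' : Measurable fun x : EuclideanSpace ℝ (Fin n) => Φ (signedNorm x) :=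
      hΦ.comp measurable_signedNorm
    have hw' : Measurable fun t : ℝ => w ‖t‖₊ := hw.comp measurable_nnnorm
    have h := lintegral_bowTie_signedNorm (n := n) (hΦ.mul hw') hn
    have hnorm : ∀ x : EuclideanSpace ℝ (Fin n), ‖signedNorm x‖₊ = ‖x‖₊ := fun x =>
      NNReal.eq (by simpa using abs_signedNorm x)
    rw [hμ, restrict_withDensity measurableSet_bowTie, lintegral_withDensity_eq_lintegral_mul _ hwm hΦ']
    calc _ = ∫⁻ x in bowTie n, (Φ * fun t : ℝ => w ‖t‖₊) (signedNorm x) :=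
          lintegral_congr fun x => by simp [hnorm, mul_comm]
      _ = _ := by
        rw [h]
        congr 1
        refine lintegral_congr fun t => ?_
        simp only [hW, Pi.mul_apply]
        ring
  have hs0 := sphereMass_ne_zero hn
  have hst := sphereMass_ne_top (n := n)
  have hballs : ∀ m r, μ (bowTie n ∩ signedNorm ⁻¹' Metric.ball m r) =
      sphereMass n * ∫⁻ t in Metric.ball m r, W t := fun m r => by
    have hb : MeasurableSet (Metric.ball m r) := Metric.isOpen_ball.measurableSet
    have h := hpolar ((Metric.ball m r).indicator 1) (measurable_one.indicator hb)
    rw [← lintegral_indicator hb, inter_comm, ← Measure.restrict_apply (measurable_signedNorm hb),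
      ← lintegral_indicator_one (measurable_signedNorm hb)]
    calc _ = _ := h
      _ = _ := by
        congr 1
        refine lintegral_congr fun t => ?_
        by_cases ht : t ∈ Metric.ball m r <;> simp only [indicator, ht] <;> simp
  refine ⟨fun m r hr => ?_, fun m r hr => ?_, ?_⟩
  · obtain ⟨ω, hω, hω1⟩ := exists_unit_mem_pos hn
    obtain ⟨hz, hzm⟩ := signedNorm_smul hω hω1 m
    obtain ⟨z', hz'⟩ := exists_ball_subset_bowTie hn hz (δ := r / 4) (by positivity)
    have hn' : (0 : ℝ) < n := by exact_mod_cast hn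
    have hpos : 0 < μ (bowTie n ∩ signedNorm ⁻¹' Metric.ball m r) := by
      refine (hdoubling.measure_ball_pos z' (r := r / 4 / n) (by positivity)).trans_le
        (measure_mono fun u hu => ⟨(hz' hu).1, ?_⟩)
      have h1 := abs_signedNorm_sub_lt_of_mem_ball (hz' hu).1 hz (hz' hu).2
      rw [mem_preimage, Metric.mem_ball, Real.dist_eq]
      rw [hzm] at h1
      linarith
    rw [hballs] at hpos
    exact pos_of_ne_zero (right_ne_zero_of_mul hpos.ne')
  · have hfin : μ (bowTie n ∩ signedNorm ⁻¹' Metric.ball m r) < ∞ := by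
      refine (measure_mono fun x hx => ?_).trans_lt
        (hdoubling.measure_ball_lt_top 0 (|m| + r))
      have h2 := hx.2
      rw [mem_preimage, Metric.mem_ball, Real.dist_eq] at h2
      rw [mem_ball_zero_iff, ← abs_signedNorm]
      linarith [abs_sub_abs_le_abs_sub (signedNorm x) m]
    rw [hballs] at hfin
    exact ENNReal.lt_top_of_mul_ne_top_right hfin.ne hs0
  · obtain ⟨K, hK⟩ := shell_estimate hn hp hdoubling hPI
    refine ⟨K, fun m r hr G M hG hM => ?_⟩
    have hb : MeasurableSet (Metric.ball m r) := Metric.isOpen_ball.measurableSet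
    -- Truncation to the interval supplies the support condition and turns the full integrals into
    -- integrals over the interval.
    set G' : ℝ → ℝ≥0 := (Metric.ball m r).indicator G with hG'
    have hG'm : Measurable G' := hG.indicator hb
    have h := hK m r hr G' M hG'm
      (fun t => (indicator_le_self _ _ t).trans (hM t))
      (fun t ht => indicator_of_notMem (by rwa [Real.ball_eq_Ioo]) _)
    rw [hballs, hpolar (fun t => (G' t : ℝ≥0∞) ^ p)
      (hG'm.coe_nnreal_ennreal.pow_const p)] at h
    have h2 : ∫⁻ t, (G' t : ℝ≥0∞) = ∫⁻ t in Metric.ball m r, (G t : ℝ≥0∞) := by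
      rw [← lintegral_indicator hb]
      refine lintegral_congr fun t => ?_
      by_cases ht : t ∈ Metric.ball m r
      · rw [hG', indicator_of_mem ht, indicator_of_mem ht]
      · rw [hG', indicator_of_notMem ht, indicator_of_notMem ht, ENNReal.coe_zero]
    have h3 : ∫⁻ t, (G' t : ℝ≥0∞) ^ p * W t =
        ∫⁻ t in Metric.ball m r, (G t : ℝ≥0∞) ^ p * W t := by
      rw [← lintegral_indicator hb]
      refine lintegral_congr fun t => ?_
      by_cases ht : t ∈ Metric.ball m r
      · rw [hG', indicator_of_mem ht, indicator_of_mem ht]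
      · rw [hG', indicator_of_notMem ht, indicator_of_notMem ht, ENNReal.coe_zero,
          ENNReal.zero_rpow_of_pos hp0, zero_mul]
    rw [h2, h3] at h
    refine (ENNReal.mul_le_mul_iff_right hs0 hst).1 ?_
    calc _ = _ := by ring
      _ ≤ _ := h
      _ = _ := by ring

end BowTie

/-! ### From the testing inequality to the `A_p` condition. -/

namespace BowTie

theorem lt_add_one_mul_of_le_mul {a Q : ℝ≥0∞} {C : ℝ≥0} (ha : a ≠ 0) (ha' : a ≠ ∞)
    (h : a ≤ C * Q) : a < ((C + 1 : ℝ≥0) : ℝ≥0∞) * Q := by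
  have hQ : Q ≠ 0 := by
    rintro rfl
    exact ha (by simpa using h)
  rcases eq_or_ne Q ∞ with rfl | hQ'
  · rw [ENNReal.mul_top (by simp)]
    exact ha'.lt_top
  · refine h.trans_lt ?_
    push_cast
    rw [add_mul, one_mul]
    exact ENNReal.lt_add_right (ENNReal.mul_ne_top ENNReal.coe_ne_top hQ') hQ

section

variable {p : ℝ} {W : ℝ → ℝ≥0∞} {ν : Measure ℝ} [IsFiniteMeasure ν] {L : ℝ≥0∞}

/-- Testing with regularizations of `W ^ (1 / (1 - p))`. -/
theorem rpow_lintegral_mul_le (hp : 1 < p) (hW : Measurable W) (hI : ∫⁻ t, W t ∂ν ≠ ∞)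
    (h : ∀ (G : ℝ → ℝ≥0) (M : ℝ≥0), Measurable G → (∀ t, G t ≤ M) →
      (∫⁻ t, G t ∂ν) ^ p * ∫⁻ t, W t ∂ν ≤ L * ∫⁻ t, (G t : ℝ≥0∞) ^ p * W t ∂ν) :
    (∫⁻ t, W t ^ (1 / (1 - p)) ∂ν) ^ (p - 1) * ∫⁻ t, W t ∂ν ≤ L := by
  have hp1 : 0 < p - 1 := by linarith
  set q : ℝ := 1 / (p - 1) with hq
  have hq0 : 0 < q := by positivity
  have hqp : q * (p - 1) = 1 := one_div_mul_cancel hp1.ne'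
  have hneg : 1 / (1 - p) = -q := by rw [hq, ← neg_sub p 1, one_div_neg_eq_neg_one_div]
  set ε : ℕ → ℝ≥0∞ := fun k => ((k : ℝ≥0∞) + 1)⁻¹ with hε
  have hε0 : ∀ k, ε k ≠ 0 := fun k => by simp [hε]
  -- Adding `ε k` keeps the test function bounded where `W` vanishes, so its integral is finite and
  -- can be cancelled. Since `q (p - 1) = 1`, one has `g^p = g / (W + ε)`, hence `g^p W ≤ g`.
  -- Monotone convergence then removes `ε k`.
  set g : ℕ → ℝ → ℝ≥0∞ := fun k t => ((W t + ε k)⁻¹) ^ q with hg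
  have hgm : ∀ k, Measurable (g k) := fun k => ((hW.add_const _).inv).pow_const q
  have hgb : ∀ k t, g k t ≤ (ε k)⁻¹ ^ q := fun k t =>
    ENNReal.rpow_le_rpow (ENNReal.inv_le_inv.2 le_add_self) hq0.le
  have hbt : ∀ k, (ε k)⁻¹ ^ q ≠ ∞ := fun k =>
    ENNReal.rpow_ne_top_of_nonneg hq0.le (ENNReal.inv_ne_top.2 (hε0 k))
  have hgt : ∀ k t, g k t ≠ ∞ := fun k t => ((hgb k t).trans_lt (hbt k).lt_top).ne
  have hstep : ∀ k, (∫⁻ t, g k t ∂ν) ^ (p - 1) * ∫⁻ t, W t ∂ν ≤ L := by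
    intro k
    have h1 := h (fun t => (g k t).toNNReal) ((ε k)⁻¹ ^ q).toNNReal (hgm k).ennreal_toNNReal
      fun t => ENNReal.toNNReal_mono (hbt k) (hgb k t)
    simp only [ENNReal.coe_toNNReal (hgt k _)] at h1
    have h2 : ∀ t, g k t ^ p * W t ≤ g k t := fun t => by
      have e : g k t ^ p = g k t * (W t + ε k)⁻¹ := by
        calc g k t ^ p = g k t ^ (1 + (p - 1)) := by ring_nf
          _ = g k t * g k t ^ (p - 1) := by
            rw [ENNReal.rpow_add_of_nonneg _ _ zero_le_one hp1.le, ENNReal.rpow_one]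
          _ = _ := by rw [hg, ← ENNReal.rpow_mul, hqp, ENNReal.rpow_one]
      rw [e, mul_assoc]
      refine mul_le_of_le_one_right' ?_
      calc (W t + ε k)⁻¹ * W t ≤ (W t + ε k)⁻¹ * (W t + ε k) := by gcongr; exact le_self_add
        _ ≤ 1 := ENNReal.inv_mul_le_one _
    set S := ∫⁻ t, g k t ∂ν with hS
    have hSt : S ≠ ∞ := by
      refine ((lintegral_mono (hgb k)).trans_lt ?_).ne
      rw [lintegral_const]
      exact ENNReal.mul_lt_top (hbt k).lt_top (measure_lt_top _ _)
    have h3 : S ^ p * ∫⁻ t, W t ∂ν ≤ L * S := h1.trans (by gcongr; exact lintegral_mono h2)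
    rcases eq_or_ne S 0 with hS0 | hS0
    · rw [hS0, ENNReal.zero_rpow_of_pos hp1, zero_mul]
      exact zero_le
    · refine (ENNReal.mul_le_mul_iff_left hS0 hSt).1 ?_
      calc S ^ (p - 1) * (∫⁻ t, W t ∂ν) * S = S ^ (p - 1) * S ^ (1 : ℝ) * ∫⁻ t, W t ∂ν := by
            rw [ENNReal.rpow_one]; ring
        _ = S ^ p * ∫⁻ t, W t ∂ν := by
            rw [← ENNReal.rpow_add_of_nonneg _ _ hp1.le zero_le_one, sub_add_cancel]
        _ ≤ _ := h3
  have hεt : Filter.Tendsto ε Filter.atTop (nhds 0) := by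
    have := (ENNReal.tendsto_inv_nat_nhds_zero).comp (Filter.tendsto_add_atTop_nat 1)
    refine this.congr fun k => ?_
    simp [hε]
  have hεanti : Antitone ε := fun i j hij => ENNReal.inv_le_inv.2 (by gcongr)
  have hlim : Filter.Tendsto (fun k => ∫⁻ t, g k t ∂ν) Filter.atTop
      (nhds (∫⁻ t, W t ^ (1 / (1 - p)) ∂ν)) := by
    refine lintegral_tendsto_of_tendsto_of_monotone (fun k => (hgm k).aemeasurable)
      (.of_forall fun t i j hij => ?_) (.of_forall fun t => ?_)
    · refine ENNReal.rpow_le_rpow (ENNReal.inv_le_inv.2 ?_) hq0.le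
      gcongr
      exact hεanti hij
    · rw [hneg, ENNReal.rpow_neg, ← ENNReal.inv_rpow]
      have : Filter.Tendsto (fun k => W t + ε k) Filter.atTop (nhds (W t)) := by
        simpa using tendsto_const_nhds.add hεt
      exact (ENNReal.continuous_rpow_const.tendsto _).comp (this.inv)
  exact le_of_tendsto' (ENNReal.Tendsto.mul_const
    ((ENNReal.continuous_rpow_const.tendsto _).comp hlim) (Or.inr hI)) hstep

/-- Testing with characteristic functions of sublevel sets. -/
theorem lintegral_le_mul_of_sublevel (hW : Measurable W)
    (h : ∀ (G : ℝ → ℝ≥0) (M : ℝ≥0), Measurable G → (∀ t, G t ≤ M) →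
      (∫⁻ t, G t ∂ν) * ∫⁻ t, W t ∂ν ≤ L * ∫⁻ t, G t * W t ∂ν)
    {s : ℝ≥0∞} (hs : essInf W ν < s) : ∫⁻ t, W t ∂ν ≤ L * s := by
  have hE : MeasurableSet {t | W t < s} := measurableSet_lt hW measurable_const
  have hE0 : ν {t | W t < s} ≠ 0 := fun h0 => by
    refine hs.not_ge (le_essInf_of_ae_le s ?_)
    filter_upwards [measure_eq_zero_iff_ae_notMem.1 h0] with t ht
    exact not_lt.1 ht
  have h1 := h ({t | W t < s}.indicator 1) 1 (measurable_one.indicator hE)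
    fun t => indicator_le_self' (fun _ _ => zero_le) t
  have hcoe : ∀ t, (({t | W t < s}.indicator (1 : ℝ → ℝ≥0) t : ℝ≥0) : ℝ≥0∞) =
      {t | W t < s}.indicator 1 t := fun t => by
    by_cases ht : t ∈ {t | W t < s}
    · rw [indicator_of_mem ht, indicator_of_mem ht]; rfl
    · rw [indicator_of_notMem ht, indicator_of_notMem ht, ENNReal.coe_zero]
  simp only [hcoe] at h1
  rw [lintegral_indicator_one hE] at h1
  have h2 : ∫⁻ t, {t | W t < s}.indicator 1 t * W t ∂ν ≤ s * ν {t | W t < s} := by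
    rw [← setLIntegral_const, ← lintegral_indicator hE]
    refine lintegral_mono fun t => ?_
    by_cases ht : t ∈ {t | W t < s}
    · rw [indicator_of_mem ht, indicator_of_mem ht, Pi.one_apply, one_mul]
      exact ht.le
    · rw [indicator_of_notMem ht, zero_mul]
      exact zero_le
  refine (ENNReal.mul_le_mul_iff_left hE0 (measure_ne_top _ _)).1 ?_
  calc (∫⁻ t, W t ∂ν) * ν {t | W t < s} = ν {t | W t < s} * ∫⁻ t, W t ∂ν := mul_comm _ _
    _ ≤ L * (s * ν {t | W t < s}) := h1.trans (by gcongr)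
    _ = _ := by ring

end

open Classical in
theorem ap_bound_of_testing {p : ℝ} (hp : 1 ≤ p) {W : ℝ → ℝ≥0∞} (hW : Measurable W)
    (hpos : ∀ (m r : ℝ), 0 < r → 0 < ∫⁻ t in Metric.ball m r, W t)
    (hfin : ∀ (m r : ℝ), 0 < r → ∫⁻ t in Metric.ball m r, W t < ∞) {K : ℝ≥0}
    (hK : ∀ (m r : ℝ), 0 < r → ∀ (G : ℝ → ℝ≥0) (M : ℝ≥0), Measurable G → (∀ t, G t ≤ M) →
      (∫⁻ t in Metric.ball m r, G t) ^ p * ∫⁻ t in Metric.ball m r, W t ≤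
        (K * ENNReal.ofReal r ^ p) * ∫⁻ t in Metric.ball m r, (G t : ℝ≥0∞) ^ p * W t)
    (m r : ℝ) (hr : 0 < r) :
    ⨍⁻ y in Metric.ball m r, W y ∂volume < ((K + 1 + 1 : ℝ≥0) : ℝ≥0∞) *
      (if p = 1 then essInf W (volume.restrict (Metric.ball m r))
        else (⨍⁻ y in Metric.ball m r, W y ^ (1 / (1 - p)) ∂volume) ^ (1 - p)) := by
  have : IsFiniteMeasure (volume.restrict (Metric.ball m r)) :=
    ⟨by rw [Measure.restrict_apply_univ]; exact measure_ball_lt_top⟩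
  -- Replacing `K` by `K + 1` gives a nonzero constant to divide by; the second `+ 1` in the
  -- conclusion makes the inequality strict.
  have hK' : ∀ (G : ℝ → ℝ≥0) (M : ℝ≥0), Measurable G → (∀ t, G t ≤ M) →
      (∫⁻ t in Metric.ball m r, G t) ^ p * ∫⁻ t in Metric.ball m r, W t ≤
        ((K + 1 : ℝ≥0) * ENNReal.ofReal r ^ p) *
          ∫⁻ t in Metric.ball m r, (G t : ℝ≥0∞) ^ p * W t := fun G M hG hM =>
    (hK m r hr G M hG hM).trans (by gcongr; exact le_self_add)
  have hρ0 : ENNReal.ofReal r ≠ 0 := by simpa using hr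
  have hρt : ENNReal.ofReal r ≠ ∞ := ENNReal.ofReal_ne_top
  have hV : volume (Metric.ball m r) = 2 * ENNReal.ofReal r := by
    rw [Real.volume_ball, ENNReal.ofReal_mul zero_le_two, ENNReal.ofReal_ofNat]
  have hK0 : ((K + 1 : ℝ≥0) : ℝ≥0∞) ≠ 0 := by simp
  rw [setLAverage_eq, setLAverage_eq, hV]
  set ρ := ENNReal.ofReal r
  set V := 2 * ρ with hVdef
  have hV0 : V ≠ 0 := mul_ne_zero two_ne_zero hρ0
  have hVt : V ≠ ∞ := ENNReal.mul_ne_top ENNReal.ofNat_ne_top hρt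
  have hρV : ρ ≤ V := le_mul_of_one_le_left' one_le_two
  have hI0 := (hpos m r hr).ne'
  have hIt := (hfin m r hr).ne
  set I := ∫⁻ t in Metric.ball m r, W t
  refine lt_add_one_mul_of_le_mul (ENNReal.div_ne_zero.2 ⟨hI0, hVt⟩)
    (ENNReal.div_ne_top hIt hV0) ?_
  split_ifs with h1
  · subst h1
    simp only [ENNReal.rpow_one] at hK'
    by_contra! hlt
    rw [mul_comm, ← ENNReal.lt_div_iff_mul_lt (Or.inl hK0) (Or.inl ENNReal.coe_ne_top)] at hlt
    have h2 := lintegral_le_mul_of_sublevel hW hK' hlt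
    -- The interval has length `V = 2ρ`, so testing at the level `s = I / V / (K + 1)` gains a
    -- factor `2`, impossible for `0 < I < ∞`.
    have h3 : I * 2 ≤ I := by
      calc I * 2 ≤ (K + 1 : ℝ≥0) * ρ * (I / V / (K + 1 : ℝ≥0)) * 2 := by gcongr
        _ = ((K + 1 : ℝ≥0) * (I / V / (K + 1 : ℝ≥0))) * V := by rw [hVdef]; ring
        _ = I := by
          rw [ENNReal.mul_div_cancel hK0 ENNReal.coe_ne_top, ENNReal.div_mul_cancel hV0 hVt]
    rw [mul_two] at h3
    exact (ENNReal.lt_add_right hIt hI0).not_ge h3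
  · have hp1 : 1 < p := lt_of_le_of_ne hp (Ne.symm h1)
    have h2 := rpow_lintegral_mul_le hp1 hW hIt hK'
    have hp0 : 0 ≤ p - 1 := by linarith
    set S := ∫⁻ t in Metric.ball m r, W t ^ (1 / (1 - p))
    have hρp0 : ρ ^ p ≠ 0 := by simp [ENNReal.rpow_eq_zero_iff, hρ0, hρt]
    have hρpt : ρ ^ p ≠ ∞ := ENNReal.rpow_ne_top_of_nonneg (by linarith) hρt
    rw [mul_comm, ← ENNReal.le_div_iff_mul_le (Or.inr (mul_ne_zero hK0 hρp0))
      (Or.inr (ENNReal.mul_ne_top ENNReal.coe_ne_top hρpt))] at h2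
    have hVp : ρ ^ p ≤ V ^ (p - 1) * V := by
      calc ρ ^ p ≤ V ^ p := ENNReal.rpow_le_rpow hρV (by linarith)
        _ = V ^ (p - 1 + 1) := by rw [sub_add_cancel]
        _ = _ := by rw [ENNReal.rpow_add_of_nonneg _ _ hp0 zero_le_one, ENNReal.rpow_one]
    have hSV : (S / V) ^ (1 - p) = V ^ (p - 1) / S ^ (p - 1) := by
      rw [← neg_sub p 1, ENNReal.rpow_neg, ENNReal.div_rpow_of_nonneg _ _ hp0,
        ENNReal.inv_div (Or.inl (ENNReal.rpow_ne_top_of_nonneg hp0 hVt))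
          (Or.inl (by simp [ENNReal.rpow_eq_zero_iff, hV0, hVt]))]
    rw [hSV]
    refine ENNReal.div_le_of_le_mul (h2.trans ?_)
    calc (K + 1 : ℝ≥0) * ρ ^ p / S ^ (p - 1)
        ≤ (K + 1 : ℝ≥0) * (V ^ (p - 1) * V) / S ^ (p - 1) := by gcongr
      _ = _ := by simp only [div_eq_mul_inv]; ring

end BowTie

theorem mainTheorem7 (n : ℕ) (hn : 1 ≤ n) (p : ℝ) (hp : 1 ≤ p)
    (w : ℝ≥0 → ℝ≥0∞)
    (hw : BowTie.IsWeight (fun x : EuclideanSpace ℝ (Fin n) => w ‖x‖₊))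
    (μ : Measure (EuclideanSpace ℝ (Fin n)))
    (hμ : μ = volume.withDensity (fun x => w ‖x‖₊))
    (hdoubling : BowTie.IsDoubling μ)
    (hPI : BowTie.SupportsPoincare p
      (μ.comap (Subtype.val : BowTie.bowTie n → EuclideanSpace ℝ (Fin n)))) :
    BowTie.IsApWeight p (fun ρ : ℝ => (‖ρ‖₊ : ℝ≥0∞) ^ (n - 1) * w ‖ρ‖₊) := by
  -- Only the radial extension of `w` is known to be almost everywhere measurable. A Borel profile
  -- changes neither `μ` nor, up to null sets, the weight on the line.
  obtain ⟨w', hw'm, hae, hae'⟩ := BowTie.exists_measurable_profile hn hw.1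
  rw [withDensity_congr_ae hae] at hμ
  set W : ℝ → ℝ≥0∞ := fun t => (‖t‖₊ : ℝ≥0∞) ^ (n - 1) * w' ‖t‖₊ with hW
  have hWm : Measurable W := by
    have : Measurable fun t : ℝ => w' ‖t‖₊ := hw'm.comp measurable_nnnorm
    exact Measurable.mul (by fun_prop) this
  have hWae : (fun ρ : ℝ => (‖ρ‖₊ : ℝ≥0∞) ^ (n - 1) * w ‖ρ‖₊) =ᵐ[volume] W := by
    filter_upwards [hae'] with t ht
    simp only [hW]
    rw [ht]
  obtain ⟨hpos, hfin, K, hK⟩ := BowTie.profile_estimate hn hp hw'm hμ hdoubling hPI hW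
  refine ⟨⟨⟨W, hWm, hWae⟩, fun S hS => ?_⟩, K + 1 + 1, by positivity, fun m r hr => ?_⟩
  · obtain ⟨R, hR, hSR⟩ := hS.isBounded.subset_ball_lt 0 0
    rw [lintegral_congr_ae (ae_restrict_of_ae hWae)]
    exact (lintegral_mono_set hSR).trans_lt (hfin 0 R hR)
  · have h1 := ae_restrict_of_ae (s := Metric.ball m r) hWae
    have h2 : (fun ρ : ℝ => ((‖ρ‖₊ : ℝ≥0∞) ^ (n - 1) * w ‖ρ‖₊) ^ (1 / (1 - p)))
        =ᵐ[volume.restrict (Metric.ball m r)] fun t => W t ^ (1 / (1 - p)) := by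
      filter_upwards [h1] with t ht
      rw [ht]
    rw [laverage_congr h1, laverage_congr h2, essInf_congr_ae h1]
    exact BowTie.ap_bound_of_testing hp hWm hpos hfin hK m r hr
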